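/- Let $\bar q\in\mathbb R$ with $\bar q>-\pi^2/4$, and let $$\sigma^{(\bar q)}(\zeta)=\tfrac14\left(e^{\sqrt{\bar q}\,\zeta}+e^{-\sqrt{\bar q}\,\zeta}\right)^2$$ (so $\sigma^{(\bar q)}(\zeta)=\cos^2(\sqrt{|\bar q|}\,\zeta)$ if $\bar q<0$), and $\sigma^{(o)}\equiv 1$. For $\sigma\in\{\sigma^{(o)},\sigma^{(\bar q)}\}$, consider on $[0,1]$ the eigenvalue problem $\frac1\sigma(\sigma y')'=\lambda y$, $(\sigma y')(0)=0$, $y(1)=0$. Its eigenvalues are $-\delta_j^2$ with $0<\delta_1<\delta_2<\dots$; let $y_j$ be the eigenfunctions with $\int_0^1y_j^2\,\sigma\,d\zeta=1$, and $\xi_j=y_j(0)^2$. For each $\ell\ge1$ there are unique positive numbers $\alpha_1,\dots,\alpha_\ell,\hat\alpha_1,\dots,\hat\alpha_\ell$ (depending on $\ell$ and $\sigma$) that solve the discrete inverse spectral problem with data $\{\xi_j,\delta_j\}_{j=1}^\ell$: the tridiagonal $\ell\times\ell$ matrix $A$ of the difference operator $$(AV)_j=\frac1{\hat\alpha_j}\left(\frac{V_{j+1}-V_j}{\alpha_j}-\frac{V_j-V_{j-1}}{\alpha_{j-1}}\right),\quad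 1\le j\le\ell,\qquad V_{\ell+1}=0,\quad \frac{V_1-V_0}{\alpha_0}:=0,$$ has eigenvalues $-\delta_1^2,\dots,-\delta_\ell^2$, and eigenvectors $Y_j=(Y_{1,j},\dots,Y_{\ell,j})^T$ with $\sum_{p=1}^\ell\hat\alpha_pY_{p,j}^2=1$ and $Y_{1,j}^2=\xi_j$. Write $\alpha^{(o)}_j,\hat\alpha^{(o)}_j$ and $\alpha^{(\bar q)}_j,\hat\alpha^{(\bar q)}_j$ for these numbers when $\sigma=\sigma^{(o)}$ and $\sigma=\sigma^{(\bar q)}$. The optimal grid has the primary nodes $\zeta^{(o)}_{j+1}=\sum_{p=1}^j\alpha^{(o)}_p$ and the dual nodes $\hat\zeta^{(o)}_{j+1}=\sum_{p=1}^j\hat\alpha^{(o)}_p$, $0\le j\le\ell$. Then for every $\ell\ge1$ the equations $$\int_0^{\zeta^{(\bar q)}_{j+1}}\frac{d\zeta}{\sigma^{(\bar q)}(\zeta)}=\sum_{p=1}^j\alpha^{(\bar q)}_p,\qquad \int_0^{\hat\zeta^{(\bar q)}_{j+1}}\sigma^{(\bar q)}(\zeta)\,d\zeta=\sum_{p=1}^j\hat\alpha^{(\bar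 q)}_p,\qquad j=1,\dots,\ell,\qquad \zeta^{(\bar q)}_1=\hat\zeta^{(\bar q)}_1=0,$$ define a unique grid (the grid induced by $\sigma^{(\bar q)}$) with $\zeta^{(\bar q)}_j\in[0,1]$ and $\hat\zeta^{(\bar q)}_j\in[0,\infty)$, and $$\max_{1\le j\le\ell+1}\left|\zeta^{(\bar q)}_j-\zeta^{(o)}_j\right|\to0,\qquad \max_{1\le j\le\ell+1}\left|\hat\zeta^{(\bar q)}_j-\hat\zeta^{(o)}_j\right|\to0\qquad\text{as }\ell\to\infty.$$ -/

import Mathlib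

open Filter Topology

noncomputable section

namespace OptGrid

/-! ### The continuum spectral problem -/

/-- `y` solves, on `[0,1]`, the equation `d/dẑ (dy/dz) = lam * y` with `dz = dζ / σ` and
`dẑ = σ dζ`, that is `(1/σ) (σ y')' = lam y`, with Neumann condition `dy/dz = 0` at `ζ = 0` and
Dirichlet condition `y = 0` at `ζ = 1`. Here `p` is the flux `dy/dz = σ y'`. -/
def IsModeSolution (σ : ℝ → ℝ) (lam : ℝ) (y : ℝ → ℝ) : Prop :=
  ∃ p : ℝ → ℝ,
    (∀ ζ ∈ Set.Icc (0 : ℝ) 1, HasDerivWithinAt y (p ζ / σ ζ) (Set.Icc 0 1) ζ) ∧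
    (∀ ζ ∈ Set.Icc (0 : ℝ) 1, HasDerivWithinAt p (lam * (σ ζ * y ζ)) (Set.Icc 0 1) ζ) ∧
    p 0 = 0 ∧ y 1 = 0

/-- `lam` is an eigenvalue of the operator `d/dẑ d/dz` with the above boundary conditions. -/
def IsModeEigenvalue (σ : ℝ → ℝ) (lam : ℝ) : Prop :=
  ∃ y : ℝ → ℝ, IsModeSolution σ lam y ∧ ∃ ζ ∈ Set.Icc (0 : ℝ) 1, y ζ ≠ 0

/-- `(δ, ξ)` are the spectral data of the conductivity `σ`: the eigenvalues of `d/dẑ d/dz` are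
exactly `-(δ 0)^2 > -(δ 1)^2 > ...`, and `ξ j = (y_j 0)^2` with `y_j` an eigenfunction for
`-(δ j)^2`, normalized by `∫_0^1 y_j^2 σ dζ = 1`. The index starts at `0` instead of `1`. -/
structure IsSpectralData (σ : ℝ → ℝ) (δ ξ : ℕ → ℝ) : Prop where
  pos : ∀ j, 0 < δ j
  strictMono : StrictMono δ
  eigenvalue_iff : ∀ lam : ℝ, IsModeEigenvalue σ lam ↔ ∃ j, lam = -(δ j) ^ 2
  weight : ∀ j, ∃ y : ℝ → ℝ, IsModeSolution σ (-(δ j) ^ 2) y ∧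
    (∫ ζ in (0 : ℝ)..1, y ζ ^ 2 * σ ζ) = 1 ∧ ξ j = y 0 ^ 2

/-! ### The discrete inverse spectral problem -/

/-- Parameters `α_1, ..., α_l` (`al`) and `α̂_1, ..., α̂_l` (`hal`) of a layered network. -/
@[ext]
structure NetworkParams (l : ℕ) where
  al : Fin l → ℝ
  hal : Fin l → ℝ

/-- The tridiagonal matrix of the second order difference operator
`V ↦ (1/α̂_j) ((V_{j+1} - V_j)/α_j - (V_j - V_{j-1})/α_{j-1})`, `j = 1, ..., l`,
with `V_{l+1} = 0` and zero flux `(V_1 - V_0)/α_0 = 0`. -/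
def jacobiMatrix {l : ℕ} (c : NetworkParams l) : Matrix (Fin l) (Fin l) ℝ := fun i j =>
  if j = i then
    -(1 / c.hal i) * (1 / c.al i + if 0 < i.val then
      1 / c.al ⟨i.val - 1, lt_of_le_of_lt (Nat.sub_le _ _) i.isLt⟩ else 0)
  else if j.val = i.val + 1 then 1 / (c.hal i * c.al i)
  else if i.val = j.val + 1 then 1 / (c.hal i * c.al j)
  else 0

/-- The positive parameters `c` solve the discrete inverse spectral problem with data
`ξ_j, δ_j`, `j = 1, ..., l`: the matrix has eigenvalues `-δ_j^2`, with eigenvectors `Y_j` of norm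
one in the inner product with weights `α̂_p`, and `ξ_j` is the square of the first entry
of `Y_j`. -/
def SolvesDiscreteInverse {l : ℕ} (δ ξ : Fin l → ℝ) (c : NetworkParams l) : Prop :=
  (∀ j, 0 < c.al j) ∧ (∀ j, 0 < c.hal j) ∧
  ∀ j : Fin l, ∃ Y : Fin l → ℝ,
    Matrix.mulVec (jacobiMatrix c) Y = (-(δ j) ^ 2) • Y ∧
    ∑ p, c.hal p * Y p ^ 2 = 1 ∧
    ∀ h : 0 < l, ξ j = Y ⟨0, h⟩ ^ 2

/-- `c` is the network with `l` layers whose spectral measure is the truncation to the first `l`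
eigenvalues and weights of the spectral measure of the conductivity `σ`. -/
def IsTruncatedMeasureNetwork (σ : ℝ → ℝ) {l : ℕ} (c : NetworkParams l) : Prop :=
  ∃ δ ξ : ℕ → ℝ, IsSpectralData σ δ ξ ∧
    SolvesDiscreteInverse (fun j : Fin l => δ j) (fun j : Fin l => ξ j) c

/-! ### The conductivities -/

/-- The reference conductivity. -/
def sigmaRef : ℝ → ℝ := fun _ => 1

/-- The conductivity `(e^{√q ζ} + e^{-√q ζ})^2 / 4`, where `√q` is imaginary for `q < 0`. -/
def sigmaQ (q : ℝ) (ζ : ℝ) : ℝ :=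
  if 0 ≤ q then (Real.exp (√q * ζ) + Real.exp (-(√q * ζ))) ^ 2 / 4
  else Real.cos (√(-q) * ζ) ^ 2

/-- The two branches of `sigmaQ` are the single formula above, with either complex square root
of `q`. -/
theorem sigmaQ_eq (q ζ : ℝ) (s : ℂ) (hs : s ^ 2 = (q : ℂ)) :
    (sigmaQ q ζ : ℂ) = (1 / 4) * (Complex.exp (s * ζ) + Complex.exp (-(s * ζ))) ^ 2 := by
  unfold sigmaQ
  split_ifs with h
  · have h2 : s ^ 2 = ((√q : ℝ) : ℂ) ^ 2 := by
      rw [hs, ← Complex.ofReal_pow, Real.sq_sqrt h]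
    rcases sq_eq_sq_iff_eq_or_eq_neg.mp h2 with rfl | rfl <;> push_cast <;> ring_nf
  · have h2 : s ^ 2 = (((√(-q) : ℝ) : ℂ) * Complex.I) ^ 2 := by
      rw [hs, mul_pow, ← Complex.ofReal_pow, Real.sq_sqrt (by linarith), Complex.I_sq]
      push_cast; ring
    rcases sq_eq_sq_iff_eq_or_eq_neg.mp h2 with rfl | rfl <;>
      (push_cast; rw [Complex.cos]; ring_nf)

/-! ### Grids -/

/-- A grid with primary nodes `ζ_1, ..., ζ_{l+1}` and dual nodes `ζ̂_1, ..., ζ̂_{l+1}`. -/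
@[ext]
structure Grid (l : ℕ) where
  primary : Fin (l + 1) → ℝ
  dual : Fin (l + 1) → ℝ

/-- The optimal grid of the reference parameters:
`ζ_{j+1} = α_1 + ... + α_j` and `ζ̂_{j+1} = α̂_1 + ... + α̂_j`, for `j = 0, ..., l`. -/
def optimalGrid {l : ℕ} (c : NetworkParams l) : Grid l where
  primary j := ∑ p : Fin l with p.val < j.val, c.al p
  dual j := ∑ p : Fin l with p.val < j.val, c.hal p

/-- `g` is the grid induced by `σ` and the parameters `c`. The primary nodes are sought where
`1/σ` is known to be integrable, namely in `[0,1]`. -/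
structure IsInducedGrid (σ : ℝ → ℝ) {l : ℕ} (c : NetworkParams l) (g : Grid l) : Prop where
  primary_zero : g.primary 0 = 0
  dual_zero : g.dual 0 = 0
  primary_mem : ∀ j, g.primary j ∈ Set.Icc (0 : ℝ) 1
  dual_nonneg : ∀ j, 0 ≤ g.dual j
  primary_eq : ∀ j : Fin l,
    (∫ ζ in (0 : ℝ)..(g.primary j.succ), 1 / σ ζ) = ∑ p ∈ Finset.Iic j, c.al p
  dual_eq : ∀ j : Fin l,
    (∫ ζ in (0 : ℝ)..(g.dual j.succ), σ ζ) = ∑ p ∈ Finset.Iic j, c.hal p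

end OptGrid

end

namespace OptGrid


/-! The reference conductivity is the case `q = 0` of the family `sigmaQ q`. The substitution `u =
√σ y` turns the eigenvalue problem into `u'' = (q + lam) u`, `u' 0 = 0`, `u 1 = 0`. Passing from `σ
= 1` to `sigmaQ q` therefore moves every eigenvalue by `-q` and leaves every weight equal to `2`
(`isSpectralData_modeFreq`).

The discrete problem has the same symmetry. Let `S n` be the potentials of the reference network at
the spectral parameter `q`. They are positive because `q` lies above the discrete spectrum
(`Resolves.pot_pos`), and the steps `a n / (S n * S (n + 1))`, `h n * S n ^ 2` realize the measure
shifted by `-q` (`Resolves.shift`). A network is determined by its spectral measure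
(`Resolves.unique`), so these are the parameters for `sigmaQ q`. Their partial sums look like
discretizations of `∫ 1/σ` and `∫ σ` on the optimal grid, with `S` in place of `√σ`. The induced
nodes are thus close to the optimal ones once the ladder recursion at `q` converges uniformly to the
solutions of `u'' = q u` (`Interlaced.ladder_close`, `exists_grid_close`).

That convergence needs an optimal grid with interlacing nodes, small steps and bounded length. The
reference measure is uniform on half-integers, up to the factor `π`, so its orthogonal polynomials
are the even discrete Chebyshev polynomials and the steps are explicit (`resolves_ref`). Comparison
with the Wallis product gives `h 0 ≤ a 0 ≤ h 1 ≤ a 1 ≤ ...`; the last primary step is then the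
largest, and it is `O(l ^ (-1/2))`. The primary steps add up to the truncated Weyl function at `0`
(`Resolves.sum_a`), which Bessel's inequality bounds by `∫ 1/σ` (`sum_le_genSin_div`). For `q = 0`
this bounds the length of the optimal grid by one; for general `q` it puts the induced primary nodes
in `[0, 1]`. -/

/-! ### The ladder recursion and its Lagrange identity. -/

/-- Solutions `(V, F)` (potentials and fluxes) of the recursion
`F (n+1) = F n + lam * h n * V n`, `V (n+1) = V n + a n * F (n+1)`. -/
structure IsLadder (a h : ℕ → ℝ) (lam : ℝ) (V F : ℕ → ℝ) : Prop where
  flux : ∀ n, F (n + 1) = F n + lam * h n * V n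
  pot : ∀ n, V (n + 1) = V n + a n * F (n + 1)

/-- The solution of the ladder recursion with the initial values `x`. -/
def ladder (a h : ℕ → ℝ) (lam : ℝ) (x : ℝ × ℝ) : ℕ → ℝ × ℝ
  | 0 => x
  | n + 1 => ((ladder a h lam x n).1 +
      a n * ((ladder a h lam x n).2 + lam * h n * (ladder a h lam x n).1),
      (ladder a h lam x n).2 + lam * h n * (ladder a h lam x n).1)

theorem isLadder_ladder (a h : ℕ → ℝ) (lam : ℝ) (x : ℝ × ℝ) :
    IsLadder a h lam (fun n => (ladder a h lam x n).1) (fun n => (ladder a h lam x n).2) :=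
  ⟨fun _ => rfl, fun _ => rfl⟩

/-- The potentials with initial value `1` and initial flux `0`. -/
def pot (a h : ℕ → ℝ) (lam : ℝ) (n : ℕ) : ℝ := (ladder a h lam (1, 0) n).1

/-- The fluxes belonging to `pot`. -/
def flux (a h : ℕ → ℝ) (lam : ℝ) (n : ℕ) : ℝ := (ladder a h lam (1, 0) n).2

theorem isLadder_pot (a h : ℕ → ℝ) (lam : ℝ) :
    IsLadder a h lam (pot a h lam) (flux a h lam) := isLadder_ladder a h lam (1, 0)

@[simp] theorem pot_zero (a h : ℕ → ℝ) (lam : ℝ) : pot a h lam 0 = 1 := rfl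
@[simp] theorem flux_zero (a h : ℕ → ℝ) (lam : ℝ) : flux a h lam 0 = 0 := rfl

theorem flux_succ (a h : ℕ → ℝ) (lam : ℝ) (n : ℕ) :
    flux a h lam (n + 1) = flux a h lam n + lam * h n * pot a h lam n := rfl

theorem pot_succ (a h : ℕ → ℝ) (lam : ℝ) (n : ℕ) :
    pot a h lam (n + 1) = pot a h lam n + a n * flux a h lam (n + 1) := rfl

theorem pot_flux_congr {a h a' h' : ℕ → ℝ} (lam : ℝ) {n : ℕ}
    (H : ∀ m < n, a m = a' m ∧ h m = h' m) :
    pot a h lam n = pot a' h' lam n ∧ flux a h lam n = flux a' h' lam n := by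
  induction n with
  | zero => simp
  | succ n ih =>
    obtain ⟨h1, h2⟩ := ih fun m hm => H m (by omega)
    obtain ⟨h3, h4⟩ := H n (by omega)
    simp only [pot_succ, flux_succ, h1, h2, h3, h4, and_self]

/-- The discrete Lagrange (Christoffel-Darboux) identity. -/
theorem IsLadder.lagrange {a h : ℕ → ℝ} {lam mu : ℝ} {V F V' F' : ℕ → ℝ}
    (H : IsLadder a h lam V F) (H' : IsLadder a h mu V' F') (n : ℕ) :
    (lam - mu) * ∑ p ∈ Finset.range n, h p * V p * V' p =
      (F n * V' n - V n * F' n) - (F 0 * V' 0 - V 0 * F' 0) := by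
  induction n with
  | zero => simp
  | succ n ih =>
    rw [Finset.sum_range_succ, mul_add, ih, H.pot, H'.pot, H.flux, H'.flux]
    ring

/-! ### Networks with a given spectral measure: uniqueness and spectral shift. -/

/-- The `l` sections `a n, h n` have the spectral measure with nodes `lam k` and weights
`xi k`. -/
structure Resolves (l : ℕ) (a h : ℕ → ℝ) (lam xi : Fin l → ℝ) : Prop where
  apos : ∀ n < l, 0 < a n
  hpos : ∀ n < l, 0 < h n
  node : ∀ k, pot a h (lam k) l = 0
  norm : ∀ k, xi k * ∑ p ∈ Finset.range l, h p * pot a h (lam k) p ^ 2 = 1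

section Resolves

variable {l : ℕ} {a h a' h' : ℕ → ℝ} {lam xi : Fin l → ℝ}

theorem Resolves.xi_pos (R : Resolves l a h lam xi) (k : Fin l) : 0 < xi k := by
  have h1 := R.norm k
  have h2 : 0 ≤ ∑ p ∈ Finset.range l, h p * pot a h (lam k) p ^ 2 :=
    Finset.sum_nonneg fun p hp =>
      mul_nonneg (R.hpos p (Finset.mem_range.1 hp)).le (sq_nonneg _)
  by_contra hc
  nlinarith [mul_nonneg (sub_nonneg.2 (not_lt.1 hc)) h2]

/-- By the Lagrange identity, whose boundary terms vanish, the eigenvectors at distinct nodes are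
orthogonal. With the normalization this says `M' * M = 1` for square matrices, and `M * M' = 1` is
the orthogonality in the other index. -/
theorem Resolves.orth (R : Resolves l a h lam xi) (inj : Function.Injective lam)
    {i j : ℕ} (hi : i < l) (hj : j < l) :
    ∑ k, xi k * (pot a h (lam k) i * pot a h (lam k) j) = if i = j then 1 / h i else 0 := by
  let M : Matrix (Fin l) (Fin l) ℝ := fun p k => h p * pot a h (lam k) p
  let M' : Matrix (Fin l) (Fin l) ℝ := fun k p => xi k * pot a h (lam k) p
  have h1 : M' * M = 1 := by
    ext k m
    rw [Matrix.mul_apply, Matrix.one_apply]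
    have e : ∑ p : Fin l, M' k p * M p m =
        xi k * ∑ p ∈ Finset.range l, h p * pot a h (lam k) p * pot a h (lam m) p := by
      rw [Finset.mul_sum, ← Fin.sum_univ_eq_sum_range
        (fun p => xi k * (h p * pot a h (lam k) p * pot a h (lam m) p))]
      exact Finset.sum_congr rfl fun p _ => by simp only [M, M']; ring
    rw [e]
    split_ifs with hkm
    · subst hkm
      rw [← R.norm k]
      congr 1
      exact Finset.sum_congr rfl fun p _ => by ring
    · have := (isLadder_pot a h (lam k)).lagrange (isLadder_pot a h (lam m)) l
      simp only [R.node, flux_zero, mul_zero, zero_mul, sub_zero] at this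
      rcases mul_eq_zero.1 this with h0 | h0
      · exact absurd (inj (sub_eq_zero.1 h0)) hkm
      · rw [h0, mul_zero]
  have h2 : M * M' = 1 := mul_eq_one_comm.1 h1
  have h3 := congrFun (congrFun h2 ⟨i, hi⟩) ⟨j, hj⟩
  rw [Matrix.mul_apply, Matrix.one_apply] at h3
  have e : ∑ k, M ⟨i, hi⟩ k * M' k ⟨j, hj⟩ =
      h i * ∑ k, xi k * (pot a h (lam k) i * pot a h (lam k) j) := by
    rw [Finset.mul_sum]
    exact Finset.sum_congr rfl fun k _ => by simp only [M, M']; ring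
  rw [e] at h3
  have hp := (R.hpos i hi).ne'
  simp only [Fin.mk.injEq] at h3
  rw [eq_comm, ← mul_right_inj' hp, h3]
  split_ifs <;> simp [hp]

/-- Adds the index `i = l`, where the potential vanishes at every node. -/
theorem Resolves.orth_ne (R : Resolves l a h lam xi) (inj : Function.Injective lam)
    {i j : ℕ} (hi : i ≤ l) (hj : j < l) (hij : i ≠ j) :
    ∑ k, xi k * (pot a h (lam k) i * pot a h (lam k) j) = 0 := by
  rcases hi.lt_or_eq with hi | rfl
  · rw [R.orth inj hi hj, if_neg hij]
  · exact Finset.sum_eq_zero fun k _ => by rw [R.node]; ring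

/-- This is the Lanczos process. Once the earlier steps are known, the norm of the `n`-th potential
gives `h n`; then the `(n + 1)`-st flux is known, and orthogonality of potentials `n` and `n + 1` is
a linear equation for `a n` with nonzero coefficient. -/
theorem Resolves.unique (R : Resolves l a h lam xi) (R' : Resolves l a' h' lam xi)
    (inj : Function.Injective lam) : ∀ n < l, a n = a' n ∧ h n = h' n := by
  intro n
  induction n using Nat.strong_induction_on with
  | _ n ih =>
    intro hn
    have H : ∀ m < n, a m = a' m ∧ h m = h' m := fun m hm => ih m hm (by omega)
    have hV : ∀ x, pot a h x n = pot a' h' x n := fun x => (pot_flux_congr x H).1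
    have hF : ∀ x, flux a h x n = flux a' h' x n := fun x => (pot_flux_congr x H).2
    have e1 := R.orth inj hn hn
    have e1' := R'.orth inj hn hn
    rw [if_pos rfl] at e1 e1'
    simp only [hV] at e1
    have hh : h n = h' n := by
      have : 1 / h n = 1 / h' n := by rw [← e1, e1']
      simpa using this
    refine ⟨?_, hh⟩
    have key : ∀ {a h : ℕ → ℝ}, Resolves l a h lam xi →
        1 / h n + a n * ∑ k, xi k * (flux a h (lam k) (n + 1) * pot a h (lam k) n) = 0 := by
      intro a h R
      have e2 := R.orth_ne inj (i := n + 1) (by omega) hn (by omega)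
      have e3 := R.orth inj hn hn
      rw [if_pos rfl] at e3
      rw [← e3, ← e2, Finset.mul_sum, ← Finset.sum_add_distrib]
      exact Finset.sum_congr rfl fun k _ => by rw [pot_succ]; ring
    have k1 := key R
    have k2 := key R'
    simp only [flux_succ, hF, hV, hh] at k1 k2
    set Z := ∑ k, xi k * ((flux a' h' (lam k) n + lam k * h' n * pot a' h' (lam k) n) *
      pot a' h' (lam k) n)
    have hz : Z ≠ 0 := by
      intro hz
      rw [hz, mul_zero, add_zero] at k2
      exact (one_div_pos.2 (R'.hpos n hn)).ne' k2
    have : a n * Z = a' n * Z := by linarith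
    exact mul_right_cancel₀ hz this

/-- The value of the Weyl function at the spectral parameter `0`. -/
theorem Resolves.sum_a (R : Resolves l a h lam xi) (inj : Function.Injective lam)
    (hl : 0 < l) (hlam : ∀ k, lam k ≠ 0) :
    ∑ p ∈ Finset.range l, a p = ∑ k, xi k / -(lam k) := by
  have hF : ∀ x n, flux a h x n = x * ∑ i ∈ Finset.range n, h i * pot a h x i := by
    intro x n
    induction n with
    | zero => simp
    | succ n ih => rw [flux_succ, ih, Finset.sum_range_succ]; ring
  have hV : ∀ x n, pot a h x n = 1 + ∑ p ∈ Finset.range n, a p * flux a h x (p + 1) := by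
    intro x n
    induction n with
    | zero => simp
    | succ n ih => rw [pot_succ, ih, Finset.sum_range_succ]; ring
  -- Both recursions summed up, at a node, where the last potential is zero. The factor `pot 0 = 1`
  -- is inserted so that, after summation over `k`, orthogonality leaves only `i = 0`.
  have h1 : ∀ k, xi k / -(lam k) = ∑ p ∈ Finset.range l, a p *
      ∑ i ∈ Finset.range (p + 1), h i * (xi k * (pot a h (lam k) i * pot a h (lam k) 0)) := by
    intro k
    have := hV (lam k) l
    rw [R.node] at this
    simp only [hF] at this
    have e : ∑ p ∈ Finset.range l, a p * (lam k * ∑ i ∈ Finset.range (p + 1),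
        h i * pot a h (lam k) i) = lam k * ∑ p ∈ Finset.range l, a p *
          ∑ i ∈ Finset.range (p + 1), h i * pot a h (lam k) i := by
      rw [Finset.mul_sum]
      exact Finset.sum_congr rfl fun p _ => by ring
    rw [e] at this
    have e2 : ∑ p ∈ Finset.range l, a p *
      ∑ i ∈ Finset.range (p + 1), h i * (xi k * (pot a h (lam k) i * pot a h (lam k) 0)) =
        xi k * ∑ p ∈ Finset.range l, a p *
          ∑ i ∈ Finset.range (p + 1), h i * pot a h (lam k) i := by
      rw [Finset.mul_sum]
      refine Finset.sum_congr rfl fun p _ => ?_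
      rw [Finset.mul_sum, Finset.mul_sum, Finset.mul_sum]
      exact Finset.sum_congr rfl fun i _ => by rw [pot_zero]; ring
    rw [e2, div_eq_iff (neg_ne_zero.2 (hlam k))]
    linear_combination (-xi k) * this
  simp only [h1]
  rw [Finset.sum_comm]
  refine Finset.sum_congr rfl fun p hp => ?_
  rw [← Finset.mul_sum, Finset.sum_comm, Finset.sum_range_succ']
  have hp := Finset.mem_range.1 hp
  have z : ∑ i ∈ Finset.range p, ∑ k, h (i + 1) *
      (xi k * (pot a h (lam k) (i + 1) * pot a h (lam k) 0)) = 0 := by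
    refine Finset.sum_eq_zero fun i hi => ?_
    have := Finset.mem_range.1 hi
    rw [← Finset.mul_sum, R.orth_ne inj (by omega) hl (by omega), mul_zero]
  rw [z, ← Finset.mul_sum, R.orth inj hl hl, if_pos rfl, zero_add,
    mul_one_div_cancel (R.hpos 0 hl).ne', mul_one]

/-- The Christoffel-Darboux kernel `G` reproduces `pot q m` and is orthogonal to the next potential.
The Lagrange identity therefore evaluates `∑ xi k * G k ^ 2 * (q - lam k)`, a positive quantity, as
`pot q (m + 1) * pot q m / a m`, so positivity passes from `m` to `m + 1`. -/
theorem Resolves.pot_pos (R : Resolves l a h lam xi) (inj : Function.Injective lam)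
    {q : ℝ} (hq : ∀ k, lam k < q) : ∀ m ≤ l, 0 < pot a h q m := by
  intro m
  induction m with
  | zero => simp
  | succ m ih =>
    intro hm
    have hm' : m < l := by omega
    have hs := ih (by omega)
    set G : Fin l → ℝ := fun k => ∑ p ∈ Finset.range (m + 1),
      h p * pot a h q p * pot a h (lam k) p with hG
    have hGV : ∀ i ≤ l, ∑ k, xi k * (G k * pot a h (lam k) i) =
        ∑ p ∈ Finset.range (m + 1), h p * pot a h q p *
          ∑ k, xi k * (pot a h (lam k) i * pot a h (lam k) p) := by
      intro i _
      simp only [hG, Finset.sum_mul, Finset.mul_sum]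
      rw [Finset.sum_comm]
      exact Finset.sum_congr rfl fun p _ => Finset.sum_congr rfl fun k _ => by ring
    have g1 : ∑ k, xi k * (G k * pot a h (lam k) (m + 1)) = 0 := by
      rw [hGV _ hm]
      refine Finset.sum_eq_zero fun p hp => ?_
      have := Finset.mem_range.1 hp
      rw [R.orth_ne inj hm (by omega) (by omega), mul_zero]
    have g2 : ∑ k, xi k * (G k * pot a h (lam k) m) = pot a h q m := by
      rw [hGV _ hm'.le, Finset.sum_range_succ, R.orth inj hm' hm', if_pos rfl,
        Finset.sum_eq_zero, zero_add]
      · field_simp [(R.hpos m hm').ne']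
      · intro p hp
        have := Finset.mem_range.1 hp
        rw [R.orth_ne inj hm'.le (by omega) (by omega), mul_zero]
    have key : ∑ k, xi k * G k ^ 2 * (q - lam k) =
        pot a h q (m + 1) * pot a h q m / a m := by
      have : ∀ k, xi k * G k ^ 2 * (q - lam k) =
          (flux a h q (m + 1) - pot a h q (m + 1) / a m) *
            (xi k * (G k * pot a h (lam k) (m + 1))) +
          pot a h q (m + 1) / a m * (xi k * (G k * pot a h (lam k) m)) := by
        intro k
        have e := (isLadder_pot a h q).lagrange (isLadder_pot a h (lam k)) (m + 1)
        simp only [flux_zero, mul_zero, zero_mul, sub_zero] at e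
        have e2 := pot_succ a h (lam k) m
        have e3 : flux a h (lam k) (m + 1) =
            (pot a h (lam k) (m + 1) - pot a h (lam k) m) / a m := by
          rw [e2]; field_simp [(R.apos m hm').ne']; ring
        rw [e3] at e
        have e' : (q - lam k) * G k = _ := e
        linear_combination xi k * G k * e'
      rw [Finset.sum_congr rfl fun k _ => this k, Finset.sum_add_distrib, ← Finset.mul_sum,
        ← Finset.mul_sum, g1, g2]
      ring
    have hpos : 0 < ∑ k, xi k * G k ^ 2 * (q - lam k) := by
      have nn : ∀ k ∈ Finset.univ, 0 ≤ xi k * G k ^ 2 * (q - lam k) := fun k _ =>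
        mul_nonneg (mul_nonneg (R.xi_pos k).le (sq_nonneg _)) (sub_nonneg.2 (hq k).le)
      refine (Finset.sum_nonneg nn).lt_of_ne fun h0 => ?_
      have := (Finset.sum_eq_zero_iff_of_nonneg nn).1 h0.symm
      have hz : ∀ k, G k = 0 := by
        intro k
        have h3 := this k (Finset.mem_univ k)
        simpa [(R.xi_pos k).ne', (sub_pos.2 (hq k)).ne'] using h3
      simp only [hz, zero_mul, mul_zero, Finset.sum_const_zero] at g2
      exact hs.ne g2
    rw [key] at hpos
    have ha := R.apos m hm'
    have := (div_pos_iff_of_pos_right ha).1 hpos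
    exact (pos_iff_pos_of_mul_pos this).2 hs

/-- Shifting the spectral parameter by `q` amounts to a discrete Liouville transformation. -/
theorem Resolves.shift (R : Resolves l a h lam xi) (inj : Function.Injective lam)
    {q : ℝ} (hq : ∀ k, lam k < q) :
    Resolves l (fun n => a n / (pot a h q n * pot a h q (n + 1)))
      (fun n => h n * pot a h q n ^ 2) (fun k => lam k - q) xi := by
  have hs := R.pot_pos inj hq
  -- The transformed potentials are quotients by the solution at `q`, and the transformed fluxes are
  -- Wronskians with it. The zero at index `l` and the weighted norms are thereby preserved.
  have tr : ∀ x, ∀ n ≤ l,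
      pot (fun n => a n / (pot a h q n * pot a h q (n + 1)))
        (fun n => h n * pot a h q n ^ 2) (x - q) n = pot a h x n / pot a h q n ∧
      flux (fun n => a n / (pot a h q n * pot a h q (n + 1)))
        (fun n => h n * pot a h q n ^ 2) (x - q) n =
          flux a h x n * pot a h q n - pot a h x n * flux a h q n := by
    intro x n
    induction n with
    | zero => simp
    | succ n ih =>
      intro hn
      obtain ⟨h1, h2⟩ := ih (by omega)
      have s1 := (hs n (by omega)).ne'
      have s2 := (hs (n + 1) hn).ne'
      have f1 : flux (fun n => a n / (pot a h q n * pot a h q (n + 1)))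
        (fun n => h n * pot a h q n ^ 2) (x - q) (n + 1) =
          flux a h x (n + 1) * pot a h q (n + 1) - pot a h x (n + 1) * flux a h q (n + 1) := by
        rw [flux_succ, h1, h2, pot_succ a h x, pot_succ a h q, flux_succ a h x,
          flux_succ a h q]
        field_simp
        ring
      refine ⟨?_, f1⟩
      rw [pot_succ, f1, h1]
      field_simp
      rw [pot_succ a h x, pot_succ a h q]
      ring
  refine ⟨fun n hn => div_pos (R.apos n hn) (mul_pos (hs n hn.le) (hs (n + 1) hn)),
    fun n hn => mul_pos (R.hpos n hn) (pow_pos (hs n hn.le) 2), fun k => ?_, fun k => ?_⟩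
  · rw [(tr (lam k) l le_rfl).1, R.node, zero_div]
  · rw [← R.norm k]
    congr 1
    refine Finset.sum_congr rfl fun p hp => ?_
    have hp := (Finset.mem_range.1 hp).le
    rw [(tr (lam k) p hp).1]
    field_simp [(hs p hp).ne']

end Resolves

/-- Partial sums of the shifted parameters, in terms of the second solution of the ladder
recursion. -/
theorem sum_div_pot {a h : ℕ → ℝ} {q : ℝ} {T P : ℕ → ℝ} (H : IsLadder a h q T P)
    (h0 : T 0 = 0) (h1 : P 0 = 1) {n : ℕ} (hs : ∀ m ≤ n, pot a h q m ≠ 0) :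
    ∑ p ∈ Finset.range n, a p / (pot a h q p * pot a h q (p + 1)) = T n / pot a h q n := by
  -- The Wronskian is constant, and it is the numerator of the increments of `T / pot`, so the sum
  -- telescopes.
  have w : ∀ n, P n * pot a h q n - T n * flux a h q n = 1 := by
    intro n
    have := H.lagrange (isLadder_pot a h q) n
    simp only [sub_self, zero_mul, h0, h1, pot_zero, flux_zero] at this
    linarith
  induction n with
  | zero => simp [h0]
  | succ n ih =>
    rw [Finset.sum_range_succ, ih fun m hm => hs m (by omega)]
    have s1 := hs n (by omega)
    have s2 := hs (n + 1) le_rfl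
    field_simp
    rw [H.pot, H.flux, pot_succ, flux_succ]
    linear_combination (-a n) * w n


/-! ### The matrix formulation and the ladder formulation agree. -/

/-- Extension of a finite family by zero. -/
def extendZero {l : ℕ} (f : Fin l → ℝ) (n : ℕ) : ℝ := if hn : n < l then f ⟨n, hn⟩ else 0

@[simp] theorem extendZero_coe {l : ℕ} (f : Fin l → ℝ) (i : Fin l) :
    extendZero f i = f i := by simp [extendZero]

theorem extendZero_of_lt {l : ℕ} (f : Fin l → ℝ) {n : ℕ} (hn : n < l) :
    extendZero f n = f ⟨n, hn⟩ := by simp [extendZero, hn]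

/-- The value `y l = 0` encodes the Dirichlet condition, so the last row has the same form as the
others. -/
theorem jacobiMatrix_mulVec {l : ℕ} (c : NetworkParams l) (Y : Fin l → ℝ) (y : ℕ → ℝ)
    (hy : ∀ i : Fin l, y i = Y i) (hl : y l = 0) (i : Fin l) :
    (jacobiMatrix c).mulVec Y i = 1 / c.hal i * ((y (i + 1) - y i) / c.al i -
      if 0 < i.val then (y i - y (i - 1)) / extendZero c.al (i - 1) else 0) := by
  have e : ∀ j, jacobiMatrix c i j * Y j =
      (if j = i then (-(1 / c.hal i) * (1 / c.al i + if 0 < i.val then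
        1 / c.al ⟨i.val - 1, lt_of_le_of_lt (Nat.sub_le _ _) i.isLt⟩ else 0)) * y i else 0) +
      ((if j.val = i.val + 1 then 1 / (c.hal i * c.al i) * y (i + 1) else 0) +
      (if i.val = j.val + 1 then
        1 / (c.hal i * extendZero c.al (i - 1)) * y (i - 1) else 0)) := by
    intro j
    unfold jacobiMatrix
    by_cases h1 : j = i
    · subst h1
      simp [hy]
    · by_cases h2 : j.val = i.val + 1
      · have h3 : ¬ i.val = j.val + 1 := by omega
        simp only [h1, h2, if_true, if_false, zero_add]
        rw [if_neg (by omega), ← h2, hy]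
        ring
      · by_cases h3 : i.val = j.val + 1
        · have h4 : i.val - 1 = j.val := by omega
          simp only [h1, h2, if_false, h4, hy, extendZero_coe]
          rw [if_pos h3, if_pos h3]
          ring
        · simp [h1, h2, h3]
  have s2 : ∀ x : ℝ, (∑ j : Fin l, if j.val = i.val + 1 then x * y (i + 1) else 0) =
      x * y (i + 1) := by
    intro x
    by_cases hi : i.val + 1 < l
    · rw [Finset.sum_eq_single (⟨i.val + 1, hi⟩ : Fin l)]
      · simp
      · intro b _ hb
        rw [if_neg]
        intro h; exact hb (Fin.ext h)
      · simp
    · have : i.val + 1 = l := by omega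
      rw [this, hl, mul_zero]
      exact Finset.sum_eq_zero fun j _ => by simp
  have s3 : ∀ x : ℝ, (∑ j : Fin l, if i.val = j.val + 1 then x else 0) =
      if 0 < i.val then x else 0 := by
    intro x
    split_ifs with hi
    · rw [Finset.sum_eq_single (⟨i.val - 1, by omega⟩ : Fin l)]
      · rw [if_pos]; simp only; omega
      · intro b _ hb
        rw [if_neg]
        intro h; exact hb (Fin.ext (by simp only; omega))
      · simp
    · exact Finset.sum_eq_zero fun j _ => by rw [if_neg]; omega
  have s : (jacobiMatrix c).mulVec Y i = ∑ j, jacobiMatrix c i j * Y j := rfl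
  rw [s, Finset.sum_congr rfl fun j _ => e j, Finset.sum_add_distrib, Finset.sum_add_distrib, s2,
    s3, Finset.sum_ite_eq' Finset.univ i, if_pos (Finset.mem_univ i)]
  split_ifs with hi
  · rw [extendZero_of_lt c.al (by omega : i.val - 1 < l)]
    simp only [mul_inv, div_eq_mul_inv]
    ring
  · simp only [mul_inv, div_eq_mul_inv]
    ring

theorem mulVec_pot {l : ℕ} {c : NetworkParams l} (ha : ∀ j, 0 < c.al j) (hh : ∀ j, 0 < c.hal j)
    {lam : ℝ} (h0 : pot (extendZero c.al) (extendZero c.hal) lam l = 0) (x : ℝ) :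
    (jacobiMatrix c).mulVec (fun i => x * pot (extendZero c.al) (extendZero c.hal) lam i) =
      lam • fun i : Fin l => x * pot (extendZero c.al) (extendZero c.hal) lam i := by
  ext i
  rw [jacobiMatrix_mulVec c _ (fun n => x * pot (extendZero c.al) (extendZero c.hal) lam n)
    (fun _ => rfl) (by simp [h0])]
  have e1 : ∀ n, n < l → (x * pot (extendZero c.al) (extendZero c.hal) lam (n + 1) -
      x * pot (extendZero c.al) (extendZero c.hal) lam n) / extendZero c.al n =
      x * flux (extendZero c.al) (extendZero c.hal) lam (n + 1) := by
    intro n hn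
    have := ha ⟨n, hn⟩
    rw [pot_succ, extendZero_of_lt _ hn]
    field_simp
    ring
  have e2 := e1 i i.isLt
  rw [extendZero_coe] at e2
  rw [e2]
  have e3 : (if 0 < i.val then (x * pot (extendZero c.al) (extendZero c.hal) lam i -
      x * pot (extendZero c.al) (extendZero c.hal) lam (i - 1)) / extendZero c.al (i - 1)
        else 0) = x * flux (extendZero c.al) (extendZero c.hal) lam i := by
    split_ifs with hi
    · have := e1 (i.val - 1) (by omega)
      rwa [Nat.sub_add_cancel hi] at this
    · have : i.val = 0 := by omega
      simp [this]
  rw [e3, flux_succ, extendZero_coe]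
  simp only [Pi.smul_apply, smul_eq_mul]
  have := (hh i).ne'
  field_simp
  ring

/-- Each row of the eigenvalue equation determines the next entry from the previous two, as the
ladder does; at `n = l` the last row yields the node condition. -/
theorem eq_pot_of_mulVec {l : ℕ} {c : NetworkParams l} (ha : ∀ j, 0 < c.al j)
    (hh : ∀ j, 0 < c.hal j) (hl : 0 < l) {lam : ℝ} {Y : Fin l → ℝ}
    (hY : (jacobiMatrix c).mulVec Y = lam • Y) : ∀ n ≤ l,
      extendZero Y n = Y ⟨0, hl⟩ * pot (extendZero c.al) (extendZero c.hal) lam n := by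
  have row := fun i : Fin l => jacobiMatrix_mulVec c Y (extendZero Y) (extendZero_coe Y)
    (by simp [extendZero]) i
  simp only [hY, Pi.smul_apply, smul_eq_mul] at row
  have key : ∀ n, n < l → extendZero Y n =
        Y ⟨0, hl⟩ * pot (extendZero c.al) (extendZero c.hal) lam n ∧
      extendZero Y (n + 1) =
        Y ⟨0, hl⟩ * pot (extendZero c.al) (extendZero c.hal) lam (n + 1) := by
    intro n
    induction n with
    | zero =>
      intro _
      have r := row ⟨0, hl⟩
      have a0 := ha ⟨0, hl⟩
      have h0 := hh ⟨0, hl⟩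
      simp only [lt_irrefl, if_false, sub_zero, extendZero_of_lt Y hl] at r
      refine ⟨by rw [extendZero_of_lt Y hl, pot_zero, mul_one], ?_⟩
      rw [pot_succ, flux_succ, pot_zero, flux_zero, extendZero_of_lt _ hl, extendZero_of_lt _ hl]
      field_simp at r
      linarith
    | succ n ih =>
      intro hn
      obtain ⟨h1, h2⟩ := ih (by omega)
      refine ⟨h2, ?_⟩
      have r := row ⟨n + 1, hn⟩
      have a0 := ha ⟨n + 1, hn⟩
      have h0 := hh ⟨n + 1, hn⟩
      have a1 := ha ⟨n, by omega⟩
      simp only [Nat.succ_pos, if_true, Nat.add_sub_cancel, h1, h2,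
        ← extendZero_of_lt Y hn] at r
      rw [pot_succ _ _ _ (n + 1), flux_succ _ _ _ (n + 1), extendZero_of_lt c.al hn,
        extendZero_of_lt c.hal hn]
      rw [pot_succ _ _ _ n, extendZero_of_lt c.al (by omega : n < l)] at r ⊢
      field_simp at r
      have r' : c.al ⟨n, by omega⟩ * (extendZero Y (n + 1 + 1)) = c.al ⟨n, by omega⟩ * (Y ⟨0, hl⟩ *
        (pot (extendZero c.al) (extendZero c.hal) lam n + c.al ⟨n, by omega⟩ *
          flux (extendZero c.al) (extendZero c.hal) lam (n + 1) + c.al ⟨n + 1, hn⟩ *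
          (flux (extendZero c.al) (extendZero c.hal) lam (n + 1) + lam * c.hal ⟨n + 1, hn⟩ *
          (pot (extendZero c.al) (extendZero c.hal) lam n + c.al ⟨n, by omega⟩ *
          flux (extendZero c.al) (extendZero c.hal) lam (n + 1))))) := by
        linear_combination -r
      exact mul_left_cancel₀ a1.ne' r'
  intro n hn
  rcases n with _ | n
  · exact (key 0 hl).1
  · exact (key n (by omega)).2

theorem solvesDiscreteInverse_iff {l : ℕ} (hl : 0 < l) (δ ξ : Fin l → ℝ) (c : NetworkParams l) :
    SolvesDiscreteInverse δ ξ c ↔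
      Resolves l (extendZero c.al) (extendZero c.hal) (fun k => -(δ k) ^ 2) ξ := by
  have sum_eq : ∀ f : ℕ → ℝ, ∑ p : Fin l, c.hal p * f p =
      ∑ p ∈ Finset.range l, extendZero c.hal p * f p := by
    intro f
    rw [← Fin.sum_univ_eq_sum_range (fun p => extendZero c.hal p * f p)]
    simp
  constructor
  · rintro ⟨ha, hh, H⟩
    have main : ∀ k, pot (extendZero c.al) (extendZero c.hal) (-(δ k) ^ 2) l = 0 ∧
        ξ k * ∑ p ∈ Finset.range l, extendZero c.hal p *
          pot (extendZero c.al) (extendZero c.hal) (-(δ k) ^ 2) p ^ 2 = 1 := by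
      intro k
      obtain ⟨Y, hY, hn, hx⟩ := H k
      have hp := eq_pot_of_mulVec ha hh hl hY
      have hn' : ξ k * ∑ p ∈ Finset.range l, extendZero c.hal p *
          pot (extendZero c.al) (extendZero c.hal) (-(δ k) ^ 2) p ^ 2 = 1 := by
        rw [← hn, ← sum_eq, Finset.mul_sum]
        refine Finset.sum_congr rfl fun p _ => ?_
        have := hp p p.isLt.le
        rw [extendZero_coe] at this
        rw [this, hx hl]
        ring
      refine ⟨?_, hn'⟩
      have h1 := hp l le_rfl
      rw [extendZero, dif_neg (lt_irrefl l)] at h1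
      -- The first entry of the eigenvector cannot vanish, since then the whole vector would,
      -- against its normalization.
      rcases mul_eq_zero.1 h1.symm with h2 | h2
      · rw [hx hl, h2] at hn'
        norm_num at hn'
      · exact h2
    exact ⟨fun n hn => by rw [extendZero_of_lt _ hn]; exact ha _,
      fun n hn => by rw [extendZero_of_lt _ hn]; exact hh _,
      fun k => (main k).1, fun k => (main k).2⟩
  · intro R
    have ha : ∀ j, 0 < c.al j := fun j => by simpa using R.apos j j.isLt
    have hh : ∀ j, 0 < c.hal j := fun j => by simpa using R.hpos j j.isLt
    refine ⟨ha, hh, fun k => ⟨_, mulVec_pot ha hh (R.node k) (√(ξ k)), ?_, fun _ => ?_⟩⟩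
    · rw [sum_eq (fun p => (√(ξ k) *
        pot (extendZero c.al) (extendZero c.hal) (-(δ k) ^ 2) p) ^ 2), ← R.norm k,
        Finset.mul_sum]
      refine Finset.sum_congr rfl fun p _ => ?_
      rw [mul_pow, Real.sq_sqrt (R.xi_pos k).le]
      ring
    · simp [Real.sq_sqrt (R.xi_pos k).le]

theorem Resolves.congr {l : ℕ} {a h a' h' : ℕ → ℝ} {lam xi : Fin l → ℝ}
    (R : Resolves l a h lam xi) (H : ∀ n < l, a n = a' n ∧ h n = h' n) :
    Resolves l a' h' lam xi := by
  have e : ∀ x, ∀ n ≤ l, pot a h x n = pot a' h' x n := fun x n hn =>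
    (pot_flux_congr x fun m hm => H m (by omega)).1
  refine ⟨fun n hn => (H n hn).1 ▸ R.apos n hn, fun n hn => (H n hn).2 ▸ R.hpos n hn,
    fun k => by rw [← e _ l le_rfl, R.node], fun k => ?_⟩
  rw [← R.norm k]
  congr 1
  refine Finset.sum_congr rfl fun p hp => ?_
  have hp := Finset.mem_range.1 hp
  rw [e _ p hp.le, (H p hp).2]

/-- The network with the sections `a n, h n`, `n < l`. -/
def networkOf (l : ℕ) (a h : ℕ → ℝ) : NetworkParams l := ⟨fun i => a i, fun i => h i⟩

theorem solvesDiscreteInverse_networkOf {l : ℕ} (hl : 0 < l) {δ ξ : Fin l → ℝ} {a h : ℕ → ℝ}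
    (R : Resolves l a h (fun k => -(δ k) ^ 2) ξ) :
    SolvesDiscreteInverse δ ξ (networkOf l a h) :=
  (solvesDiscreteInverse_iff hl δ ξ _).2 <| R.congr fun n hn => by
    simp [networkOf, extendZero_of_lt _ hn]

theorem eq_networkOf {l : ℕ} (hl : 0 < l) {δ ξ : Fin l → ℝ} {a h : ℕ → ℝ}
    (R : Resolves l a h (fun k => -(δ k) ^ 2) ξ)
    (inj : Function.Injective fun k => -(δ k) ^ 2) {c : NetworkParams l}
    (hc : SolvesDiscreteInverse δ ξ c) : c = networkOf l a h := by
  have := ((solvesDiscreteInverse_iff hl δ ξ c).1 hc).unique R inj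
  ext i
  · simpa [networkOf] using (this i i.isLt).1
  · simpa [networkOf] using (this i i.isLt).2


/-! ### The reference network in terms of discrete Chebyshev polynomials. -/

/-- Multiplication by `lam` is symmetric for `ip`. Computing the pairing of `lam * V j` with `V (j +
1)` from two consecutive flux equations shows that `h j * ip (V j) (V j)` does not depend on `j`;
`h0` makes it one. The vectors `V 0, ..., V (l - 1)` then form an orthogonal basis, and `V l`,
orthogonal to all of them, is zero. -/
theorem resolves_of_orth {l : ℕ} {a h : ℕ → ℝ} {lam xi : Fin l → ℝ}
    (apos : ∀ n < l, 0 < a n) (hpos : ∀ n < l, 0 < h n)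
    (orth : ∀ i ≤ l, ∀ j < l, i ≠ j →
      ∑ k, xi k * (pot a h (lam k) i * pot a h (lam k) j) = 0)
    (h0 : h 0 * ∑ k, xi k = 1) : Resolves l a h lam xi := by
  let ip : (Fin l → ℝ) → (Fin l → ℝ) → ℝ := fun f g => ∑ k, xi k * (f k * g k)
  have add_ip : ∀ f g w x y, ip (fun k => x * f k + y * g k) w = x * ip f w + y * ip g w := by
    intro f g w x y
    simp only [ip, Finset.mul_sum, ← Finset.sum_add_distrib]
    exact Finset.sum_congr rfl fun k _ => by ring
  let V : ℕ → Fin l → ℝ := fun n k => pot a h (lam k) n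
  let F : ℕ → Fin l → ℝ := fun n k => flux a h (lam k) n
  have hF : ∀ j < l, F (j + 1) = fun k => (1 / a j) * V (j + 1) k + (-(1 / a j)) * V j k := by
    intro j hj
    ext k
    simp only [F, V, pot_succ]
    field_simp [(apos j hj).ne']
    ring
  have ort : ∀ i ≤ l, ∀ j < l, i ≠ j → ip (V i) (V j) = 0 := orth
  have step : ∀ j, j + 1 < l →
      h (j + 1) * ip (V (j + 1)) (V (j + 1)) = h j * ip (V j) (V j) := by
    intro j hj
    have e1 : ip (F (j + 1)) (V (j + 1)) = 1 / a j * ip (V (j + 1)) (V (j + 1)) := by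
      rw [hF j (by omega), add_ip, ort j (by omega) (j + 1) hj (by omega)]; ring
    have e2 : ip (F j) (V (j + 1)) = 0 := by
      rcases j with _ | j
      · simp [ip, F]
      · rw [hF j (by omega), add_ip, ort j (by omega) _ hj (by omega),
          ort (j + 1) (by omega) _ hj (by omega)]; ring
    have e3 : ip (F (j + 2)) (V j) = 0 := by
      rw [hF (j + 1) hj, add_ip, ort (j + 2) (by omega) _ (by omega) (by omega),
        ort (j + 1) (by omega) _ (by omega) (by omega)]; ring
    have e4 : ip (F (j + 1)) (V j) = -(1 / a j) * ip (V j) (V j) := by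
      rw [hF j (by omega), add_ip, ort (j + 1) (by omega) _ (by omega) (by omega)]; ring
    have e5 : ip (F (j + 1)) (V (j + 1)) = ip (F j) (V (j + 1)) +
        h j * ∑ k, xi k * lam k * (V j k * V (j + 1) k) := by
      simp only [ip, F, V, flux_succ, Finset.mul_sum, ← Finset.sum_add_distrib]
      exact Finset.sum_congr rfl fun k _ => by ring
    have e6 : ip (F (j + 2)) (V j) = ip (F (j + 1)) (V j) +
        h (j + 1) * ∑ k, xi k * lam k * (V j k * V (j + 1) k) := by
      simp only [ip, F, V, flux_succ _ _ _ (j + 1), Finset.mul_sum, ← Finset.sum_add_distrib]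
      exact Finset.sum_congr rfl fun k _ => by ring
    have ha := apos j (by omega)
    have e7 : 1 / a j * (h (j + 1) * ip (V (j + 1)) (V (j + 1))) =
        1 / a j * (h j * ip (V j) (V j)) := by
      linear_combination h (j + 1) * (-e1 + e5 + e2) + h j * (-e6 - e4 + e3)
    exact mul_left_cancel₀ (one_div_pos.2 ha).ne' e7
  have nrm : ∀ j < l, h j * ip (V j) (V j) = 1 := by
    intro j
    induction j with
    | zero => intro _; simpa [ip, V] using h0
    | succ j ih => intro hj; rw [step j hj, ih (by omega)]
  let M : Matrix (Fin l) (Fin l) ℝ := fun p k => h p * pot a h (lam k) p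
  let M' : Matrix (Fin l) (Fin l) ℝ := fun k p => xi k * pot a h (lam k) p
  have h1 : M * M' = 1 := by
    ext i j
    rw [Matrix.mul_apply, Matrix.one_apply]
    have e : ∑ k, M i k * M' k j = h i * ip (V i) (V j) := by
      simp only [ip, V, M, M', Finset.mul_sum]
      exact Finset.sum_congr rfl fun k _ => by ring
    rw [e]
    split_ifs with hij
    · subst hij; exact nrm i i.isLt
    · rw [ort i i.isLt.le j j.isLt fun h => hij (Fin.ext h), mul_zero]
  have h2 : M' * M = 1 := mul_eq_one_comm.1 h1
  have h3 : ∀ k m, ∑ p ∈ Finset.range l, xi k * (h p * (V p k * V p m)) =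
      if k = m then 1 else 0 := by
    intro k m
    have := congrFun (congrFun h2 k) m
    rw [Matrix.mul_apply, Matrix.one_apply] at this
    rw [← this, ← Fin.sum_univ_eq_sum_range (fun p => xi k * (h p * (V p k * V p m)))]
    exact Finset.sum_congr rfl fun p _ => by simp only [M, M', V]; ring
  refine ⟨apos, hpos, fun k => ?_, fun k => ?_⟩
  · have e : pot a h (lam k) l =
        ∑ m, (if m = k then 1 else 0) * V l m := by simp [V]
    rw [e]
    simp only [← h3, Finset.sum_mul]
    rw [Finset.sum_comm]
    refine Finset.sum_eq_zero fun p hp => ?_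
    have hp := Finset.mem_range.1 hp
    have := ort l le_rfl p hp (by omega)
    have e : ∑ m, xi m * (h p * (V p m * V p k)) * V l m = h p * V p k * ip (V l) (V p) := by
      simp only [ip, Finset.mul_sum]
      exact Finset.sum_congr rfl fun m _ => by ring
    rw [e, this, mul_zero]
  · have := h3 k k
    rw [if_pos rfl, ← Finset.mul_sum] at this
    rw [← this]
    congr 1
    exact Finset.sum_congr rfl fun p _ => by simp only [V]; ring

/-- The recursion coefficients of the monic polynomials that are orthogonal with respect to
the uniform measure on `2 L` points with spacing one, symmetric about zero. -/
noncomputable def chebCoeff (L : ℝ) (n : ℕ) : ℝ := (n : ℝ) ^ 2 * (4 * L ^ 2 - (n : ℝ) ^ 2) /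
  (4 * (4 * (n : ℝ) ^ 2 - 1))

/-- The monic discrete Chebyshev (Gram) polynomials on `2 L` points. -/
noncomputable def cheb (L : ℝ) : ℕ → ℝ → ℝ
  | 0, _ => 1
  | 1, t => t
  | n + 2, t => t * cheb L (n + 1) t - chebCoeff L (n + 1) * cheb L n t

theorem chebCoeff_zero (L : ℝ) : chebCoeff L 0 = 0 := by simp [chebCoeff]

theorem cheb_succ (L : ℝ) (n : ℕ) (t : ℝ) :
    cheb L (n + 1) t = t * cheb L n t - chebCoeff L n * cheb L (n - 1) t := by
  cases n with
  | zero => simp [cheb, chebCoeff_zero]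
  | succ n => rfl

/-- The compatibility condition on the coefficients that closes the induction for the first order
relation in `cheb_difference`. -/
theorem chebCoeff_rec (L : ℝ) (n : ℕ) :
    (4 * n + 6) * chebCoeff L (n + 1) - (4 * n - 2) * chebCoeff L n =
      2 * L ^ 2 - 1 / 2 - n * (n + 1) := by
  unfold chebCoeff
  have h1 : (4 * (4 * ((n + 1 : ℕ) : ℝ) ^ 2 - 1)) = 4 * ((2 * n + 1) * (2 * n + 3)) := by
    push_cast; ring
  have h2 : (4 * (4 * (n : ℝ) ^ 2 - 1)) = 4 * ((2 * n + 1) * (2 * n - 1)) := by ring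
  have n1 : (2 * (n : ℝ) + 1) ≠ 0 := by positivity
  have n3 : (2 * (n : ℝ) + 3) ≠ 0 := by positivity
  have n2 : (2 * (n : ℝ) - 1) ≠ 0 := by
    intro h
    have : (2 * (n : ℤ) - 1 : ℤ) = 0 := by exact_mod_cast h
    omega
  rw [h1, h2]
  push_cast
  generalize (n : ℝ) = x at *
  rw [mul_div_assoc', mul_div_assoc', div_sub_div _ _ (by positivity) (by positivity),
    div_eq_iff (by positivity)]
  ring

/-- The second order difference equation of the discrete Chebyshev polynomials, and the
accompanying first order relation. -/
theorem cheb_difference (L : ℝ) (n : ℕ) : ∀ t : ℝ,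
    ((L ^ 2 - (t + 1 / 2) ^ 2) * cheb L n (t + 1) + (L ^ 2 - (t - 1 / 2) ^ 2) * cheb L n (t - 1) =
      (2 * L ^ 2 - 2 * t ^ 2 - 1 / 2 - n * (n + 1)) * cheb L n t) ∧
    ((L ^ 2 - (t + 1 / 2) ^ 2) * cheb L n (t + 1) - (L ^ 2 - (t - 1 / 2) ^ 2) * cheb L n (t - 1) =
      -2 * (n + 1) * cheb L (n + 1) t + 2 * n * chebCoeff L n * cheb L (n - 1) t) := by
  -- The recurrence at `t + 1` and `t - 1` has the factors `t ± 1`, so the sum at the next degree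
  -- involves the difference at the present one, and conversely. Hence the joint induction.
  induction n using Nat.twoStepInduction with
  | zero => intro t; constructor <;> simp [cheb] <;> ring
  | one =>
    intro t
    have c1 := chebCoeff_rec L 0
    simp only [chebCoeff_zero, Nat.cast_zero] at c1
    constructor
    · simp [cheb]; ring
    · simp [cheb]
      linear_combination (-1 : ℝ) * c1
  | more n ih1 ih2 =>
    intro t
    obtain ⟨s1, k1⟩ := ih1 t
    obtain ⟨s2, k2⟩ := ih2 t
    have r1 := cheb_succ L (n + 1) (t + 1)
    have r2 := cheb_succ L (n + 1) (t - 1)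
    have r3 := cheb_succ L (n + 1) t
    have r4 := cheb_succ L (n + 2) t
    have r5 := cheb_succ L n t
    have c := chebCoeff_rec L (n + 1)
    simp only [show n + 1 + 1 = n + 2 from rfl, show n + 2 + 1 = n + 3 from rfl,
      Nat.add_sub_cancel, show n + 2 - 1 = n + 1 from rfl] at *
    push_cast at *
    constructor
    · rw [r1, r2]
      linear_combination t * s2 + k2 - chebCoeff L (n + 1) * s1 -
        (2 * L ^ 2 - 2 * t ^ 2 - 1 / 2 - (n + 2) * (n + 3)) * r3
        - 2 * (n + 2) * r3
    · rw [r1, r2]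
      linear_combination t * k2 + s2 - chebCoeff L (n + 1) * k1 +
        2 * (n + 3) * r4 + cheb L (n + 1) t * (-c) - 2 * n * chebCoeff L (n + 1) * r5 +
        2 * t * r3

theorem cheb_even (L : ℝ) (n : ℕ) : ∀ t, cheb L n (-t) = (-1) ^ n * cheb L n t := by
  induction n using Nat.twoStepInduction with
  | zero => simp [cheb]
  | one => simp [cheb]
  | more n ih1 ih2 =>
    intro t
    simp only [cheb, ih1, ih2]
    ring

/-- Orthogonality of the even discrete Chebyshev polynomials on the positive nodes. -/
theorem cheb_orth (l : ℕ) {i j : ℕ} (hij : i ≠ j) :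
    ∑ k ∈ Finset.range l, cheb l (2 * i) (k + 1 / 2) * cheb l (2 * j) (k + 1 / 2) = 0 := by
  set u := cheb l (2 * i) with hu
  set v := cheb l (2 * j) with hv
  -- Green's identity for the difference equation. The boundary term vanishes at `n = 0` by evenness
  -- and at `n = l` by the factor `l ^ 2 - n ^ 2`.
  have W : ∀ n : ℕ, (((2 * j : ℕ) : ℝ) * ((2 * j : ℕ) + 1) - ((2 * i : ℕ) : ℝ) * ((2 * i : ℕ) + 1)) *
      ∑ k ∈ Finset.range n, u (k + 1 / 2) * v (k + 1 / 2) =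
      ((l : ℝ) ^ 2 - n ^ 2) * (u (n + 1 / 2) * v (n - 1 / 2) - u (n - 1 / 2) * v (n + 1 / 2)) := by
    intro n
    induction n with
    | zero =>
      have e : (0 : ℝ) - 1 / 2 = -(0 + 1 / 2) := by norm_num
      have hu' := cheb_even l (2 * i) (0 + 1 / 2)
      have hv' := cheb_even l (2 * j) (0 + 1 / 2)
      simp only [Finset.sum_range_zero, Nat.cast_zero, e, hu, hv, hu', hv']
      simp [pow_mul]
    | succ n ih =>
      rw [Finset.sum_range_succ, mul_add, ih]
      have d1 := (cheb_difference l (2 * i) (n + 1 / 2)).1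
      have d2 := (cheb_difference l (2 * j) (n + 1 / 2)).1
      rw [← hu] at d1
      rw [← hv] at d2
      have e1 : (n : ℝ) + 1 / 2 - 1 = n - 1 / 2 := by ring
      have e2 : ((n + 1 : ℕ) : ℝ) - 1 / 2 = n + 1 / 2 := by push_cast; ring
      have e3 : ((n + 1 : ℕ) : ℝ) + 1 / 2 = n + 1 / 2 + 1 := by push_cast; ring
      rw [e1] at d1 d2
      rw [e2, e3]
      push_cast at *
      linear_combination u (n + 1 / 2) * d2 - v (n + 1 / 2) * d1
  have := W l
  rw [sub_self, zero_mul] at this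
  rcases mul_eq_zero.1 this with h | h
  · exfalso
    have h' : (2 * j) * (2 * j + 1) = (2 * i) * (2 * i + 1) := by
      have : ((2 * j : ℕ) : ℝ) * ((2 * j : ℕ) + 1) = ((2 * i : ℕ) : ℝ) * ((2 * i : ℕ) + 1) := by
        linarith
      exact_mod_cast this
    rcases lt_or_gt_of_ne hij with h1 | h1 <;> nlinarith
  · exact h

theorem chebCoeff_pos {l n : ℕ} (h0 : 0 < n) (h1 : n < 2 * l) : 0 < chebCoeff l n := by
  have a1 : (1 : ℝ) ≤ n := by exact_mod_cast h0
  have a2 : (n : ℝ) < 2 * l := by exact_mod_cast h1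
  unfold chebCoeff
  exact div_pos (mul_pos (by positivity) (by nlinarith)) (by nlinarith)

/-- The dual steps of the optimal grid. -/
noncomputable def refH (l : ℕ) : ℕ → ℝ
  | 0 => 1 / (2 * l)
  | j + 1 => refH l j * (chebCoeff l (2 * j + 1) / chebCoeff l (2 * j + 2))

/-- The primary steps of the optimal grid. -/
noncomputable def refA (l j : ℕ) : ℝ :=
  1 / (Real.pi ^ 2 * chebCoeff l (2 * j + 1) * refH l j)

theorem refH_pos {l j : ℕ} (hj : j < l) : 0 < refH l j := by
  induction j with
  | zero =>
    have : (0 : ℝ) < l := by exact_mod_cast hj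
    simp only [refH]; positivity
  | succ j ih =>
    exact mul_pos (ih (by omega)) (div_pos (chebCoeff_pos (by omega) (by omega))
      (chebCoeff_pos (by omega) (by omega)))

theorem refA_pos {l j : ℕ} (hj : j < l) : 0 < refA l j := by
  have h1 := refH_pos hj
  have h2 : 0 < chebCoeff l (2 * j + 1) := chebCoeff_pos (by omega) (by omega)
  unfold refA
  positivity

/-- The potentials of the reference network are multiples of even discrete Chebyshev
polynomials. -/
theorem pot_ref {l : ℕ} (t : ℝ) {j : ℕ} (hj : j < l) :
    pot (refA l) (refH l) (-(Real.pi * t) ^ 2) j =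
      (∏ i ∈ Finset.range j, -(1 / chebCoeff l (2 * i + 1))) * cheb l (2 * j) t ∧
    refA l j * flux (refA l) (refH l) (-(Real.pi * t) ^ 2) (j + 1) =
      (∏ i ∈ Finset.range (j + 1), -(1 / chebCoeff l (2 * i + 1))) *
        (t * cheb l (2 * j + 1) t) ∧
    pot (refA l) (refH l) (-(Real.pi * t) ^ 2) (j + 1) =
      (∏ i ∈ Finset.range (j + 1), -(1 / chebCoeff l (2 * i + 1))) * cheb l (2 * (j + 1)) t := by
  -- The three-term recurrence splits into two halves: the step to degree `2 * j + 2` is the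
  -- potential equation, proved here, and the step to the next odd degree is the flux equation.
  have next : ∀ j < l, pot (refA l) (refH l) (-(Real.pi * t) ^ 2) j =
      (∏ i ∈ Finset.range j, -(1 / chebCoeff l (2 * i + 1))) * cheb l (2 * j) t →
    refA l j * flux (refA l) (refH l) (-(Real.pi * t) ^ 2) (j + 1) =
      (∏ i ∈ Finset.range (j + 1), -(1 / chebCoeff l (2 * i + 1))) *
        (t * cheb l (2 * j + 1) t) →
    pot (refA l) (refH l) (-(Real.pi * t) ^ 2) (j + 1) =
      (∏ i ∈ Finset.range (j + 1), -(1 / chebCoeff l (2 * i + 1))) *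
        cheb l (2 * (j + 1)) t := by
    intro j hj h1 h2
    have hb := (chebCoeff_pos (l := l) (n := 2 * j + 1) (by omega) (by omega)).ne'
    rw [pot_succ, h1, h2, Finset.prod_range_succ, show 2 * (j + 1) = 2 * j + 2 by ring, cheb]
    field_simp
    ring
  have hpi := Real.pi_pos.ne'
  induction j with
  | zero =>
    have e1 : pot (refA l) (refH l) (-(Real.pi * t) ^ 2) 0 =
      (∏ i ∈ Finset.range 0, -(1 / chebCoeff l (2 * i + 1))) * cheb l (2 * 0) t := by
      simp [cheb]
    have e2 : refA l 0 * flux (refA l) (refH l) (-(Real.pi * t) ^ 2) (0 + 1) =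
      (∏ i ∈ Finset.range (0 + 1), -(1 / chebCoeff l (2 * i + 1))) *
        (t * cheb l (2 * 0 + 1) t) := by
      have hb := (chebCoeff_pos (l := l) (n := 2 * 0 + 1) (by omega) (by omega)).ne'
      have hh := (refH_pos hj).ne'
      rw [flux_succ, pot_zero, flux_zero, Finset.prod_range_one]
      simp only [cheb, refA]
      field_simp
      ring
    exact ⟨e1, e2, next 0 hj e1 e2⟩
  | succ j ih =>
    obtain ⟨-, h2, h1⟩ := ih (by omega)
    have e2 : refA l (j + 1) * flux (refA l) (refH l) (-(Real.pi * t) ^ 2) (j + 1 + 1) =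
        (∏ i ∈ Finset.range (j + 1 + 1), -(1 / chebCoeff l (2 * i + 1))) *
        (t * cheb l (2 * (j + 1) + 1) t) := by
      have hb := (chebCoeff_pos (l := l) (n := 2 * (j + 1) + 1) (by omega) (by omega)).ne'
      have hb1 := (chebCoeff_pos (l := l) (n := 2 * j + 1) (by omega) (by omega)).ne'
      have hb2 := (chebCoeff_pos (l := l) (n := 2 * j + 2) (by omega) (by omega)).ne'
      have hh := (refH_pos hj).ne'
      have hh' := (refH_pos (by omega : j < l)).ne'
      have ha := (refA_pos (by omega : j < l)).ne'
      have f : flux (refA l) (refH l) (-(Real.pi * t) ^ 2) (j + 1) =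
        (∏ i ∈ Finset.range (j + 1), -(1 / chebCoeff l (2 * i + 1))) *
        (t * cheb l (2 * j + 1) t) / refA l j := by
        rw [← h2]; field_simp
      have r : refA l (j + 1) * (-(Real.pi * t) ^ 2 * refH l (j + 1)) =
          -(1 / chebCoeff l (2 * (j + 1) + 1)) * t ^ 2 := by
        simp only [refA]; field_simp
      have r' : refA l (j + 1) / refA l j = chebCoeff l (2 * j + 2) /
          chebCoeff l (2 * (j + 1) + 1) := by
        have : refH l (j + 1) =
          refH l j * (chebCoeff l (2 * j + 1) / chebCoeff l (2 * j + 2)) := rfl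
        simp only [refA, this]
        field_simp
      rw [flux_succ, h1, Finset.prod_range_succ _ (j + 1), cheb_succ l (2 * (j + 1)),
        show 2 * (j + 1) - 1 = 2 * j + 1 by omega, mul_add, f]
      set κ := ∏ i ∈ Finset.range (j + 1), -(1 / chebCoeff l (2 * i + 1))
      have : refA l (j + 1) * (κ * (t * cheb l (2 * j + 1) t) / refA l j) =
        κ * (t * cheb l (2 * j + 1) t) * (refA l (j + 1) / refA l j) := by ring
      rw [this, r']
      have : refA l (j + 1) * (-(Real.pi * t) ^ 2 * refH l (j + 1) * (κ * cheb l (2 * (j + 1)) t)) =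
        κ * cheb l (2 * (j + 1)) t * (refA l (j + 1) * (-(Real.pi * t) ^ 2 * refH l (j + 1))) := by
        ring
      rw [this, r, show 2 * (j + 1) = 2 * j + 2 by ring]
      field_simp
      ring
    exact ⟨h1, e2, next (j + 1) hj h1 e2⟩

/-- The reference network resolves the first `l` eigenvalues and weights of the constant
conductivity. -/
theorem resolves_ref (l : ℕ) (hl : 0 < l) :
    Resolves l (refA l) (refH l) (fun k => -(Real.pi * (k + 1 / 2)) ^ 2) (fun _ => 2) := by
  have e : ∀ t, ∀ j ≤ l, pot (refA l) (refH l) (-(Real.pi * t) ^ 2) j =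
      (∏ i ∈ Finset.range j, -(1 / chebCoeff l (2 * i + 1))) * cheb l (2 * j) t := by
    intro t j hj
    rcases j with _ | j
    · exact (pot_ref t hl).1
    · exact (pot_ref t (by omega : j < l)).2.2
  -- The points `k + 1 / 2` are the positive half of the symmetric `2 l` points. The first dual step
  -- is `1 / (2 * l)` because the weights add up to `2 * l`.
  refine resolves_of_orth (fun n hn => refA_pos hn) (fun n hn => refH_pos hn) ?_ ?_
  · intro i hi j hj hij
    simp only [e _ i hi, e _ j hj.le]
    have := cheb_orth l hij
    rw [← Fin.sum_univ_eq_sum_range (fun k : ℕ =>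
      cheb l (2 * i) (k + 1 / 2) * cheb l (2 * j) (k + 1 / 2))] at this
    set x := ∏ i ∈ Finset.range i, -(1 / chebCoeff l (2 * i + 1))
    set y := ∏ i ∈ Finset.range j, -(1 / chebCoeff l (2 * i + 1))
    rw [← mul_zero (2 * x * y), ← this, Finset.mul_sum]
    exact Finset.sum_congr rfl fun k _ => by ring
  · have : (l : ℝ) ≠ 0 := by exact_mod_cast hl.ne'
    simp only [refH, Finset.sum_const, Finset.card_univ, Fintype.card_fin, nsmul_eq_mul]
    field_simp


/-! ### Interlacing and size of the optimal grid steps, by Wallis' product. -/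

/-- The factor of `chebCoeff` that does not depend on the number of points. -/
noncomputable def legCoeff (n : ℕ) : ℝ := (n : ℝ) ^ 2 / (4 * (n : ℝ) ^ 2 - 1)

theorem chebCoeff_eq (L : ℝ) (n : ℕ) :
    chebCoeff L n = legCoeff n * (4 * L ^ 2 - (n : ℝ) ^ 2) / 4 := by
  unfold chebCoeff legCoeff
  rw [div_mul_eq_mul_div, div_div, mul_comm (4 * (n : ℝ) ^ 2 - 1)]

theorem legCoeff_pos {n : ℕ} (h0 : 0 < n) : 0 < legCoeff n := by
  have a1 : (1 : ℝ) ≤ n := by exact_mod_cast h0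
  unfold legCoeff
  exact div_pos (by positivity) (by nlinarith)

/-- The factor `4 * l ^ 2 - n ^ 2` is log-concave in `n`. This replaces the `l`-dependent
coefficients by their limiting ratios as `l → ∞`. -/
theorem chebCoeff_ratio_le {l n : ℕ} (h0 : 0 < n) (h1 : n + 2 < 2 * l) :
    chebCoeff l n * chebCoeff l (n + 2) / chebCoeff l (n + 1) ^ 2 ≤
      legCoeff n * legCoeff (n + 2) / legCoeff (n + 1) ^ 2 := by
  have p1 := legCoeff_pos h0
  have p2 := legCoeff_pos (by omega : 0 < n + 1)
  have p3 := legCoeff_pos (by omega : 0 < n + 2)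
  have q2 : 0 < chebCoeff l (n + 1) := chebCoeff_pos (by omega) (by omega)
  rw [div_le_div_iff₀ (by positivity) (by positivity)]
  simp only [chebCoeff_eq]
  set X := 4 * (l : ℝ) ^ 2 - (n : ℝ) ^ 2
  have key : X * (4 * (l : ℝ) ^ 2 - ((n + 2 : ℕ) : ℝ) ^ 2) ≤
      (4 * (l : ℝ) ^ 2 - ((n + 1 : ℕ) : ℝ) ^ 2) ^ 2 := by
    simp only [X]; push_cast
    have hn : (0 : ℝ) ≤ n := by positivity
    nlinarith [sq_nonneg (l : ℝ), sq_nonneg (n : ℝ)]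
  have := mul_le_mul_of_nonneg_left key
    (by positivity : 0 ≤ legCoeff n * legCoeff (n + 2) * legCoeff (n + 1) ^ 2 / 16)
  linarith

theorem legCoeff_odd (j : ℕ) : legCoeff (2 * j + 1) =
    (2 * j + 1 : ℝ) ^ 2 / ((4 * j + 1) * (4 * j + 3)) := by
  unfold legCoeff; push_cast; congr 1; ring

theorem legCoeff_even (j : ℕ) : legCoeff (2 * j + 2) =
    (2 * j + 2 : ℝ) ^ 2 / ((4 * j + 3) * (4 * j + 5)) := by
  unfold legCoeff; push_cast; congr 1; ring

-- The right side decreases in `j` and tends to the left side.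
open Real.Wallis in
theorem wallis_upper (j : ℕ) : (Real.pi / 2) ^ 2 ≤ W j ^ 2 * ((4 * j + 3) / (4 * j + 1)) := by
  have anti : Antitone fun j : ℕ => W j ^ 2 * ((4 * j + 3) / (4 * j + 1) : ℝ) := by
    refine antitone_nat_of_succ_le fun n => ?_
    have hW := W_pos n
    rw [W_succ, mul_pow, mul_assoc]
    refine mul_le_mul_of_nonneg_left ?_ (by positivity)
    push_cast
    rw [div_mul_div_comm, div_pow, div_mul_div_comm,
      div_le_div_iff₀ (by positivity) (by positivity)]
    have hn : (0 : ℝ) ≤ n := by positivity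
    generalize (n : ℝ) = x at *
    rw [← sub_nonneg]
    ring_nf
    positivity
  have lim : Tendsto (fun j : ℕ => W j ^ 2 * ((4 * j + 3) / (4 * j + 1) : ℝ)) atTop
      (𝓝 ((Real.pi / 2) ^ 2 * 1)) := by
    refine (tendsto_W_nhds_pi_div_two.pow 2).mul ?_
    have : Tendsto (fun n : ℕ => 1 + 2 * (1 / (4 * (n : ℝ) + 1))) atTop (𝓝 (1 + 2 * 0)) := by
      refine tendsto_const_nhds.add (tendsto_const_nhds.mul ?_)
      refine squeeze_zero (fun n => by positivity) (fun n => ?_) tendsto_one_div_add_atTop_nhds_zero_nat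
      gcongr
      have : (0 : ℝ) ≤ n := by positivity
      linarith
    refine (this.congr fun n => ?_).trans (by simp)
    field_simp
    ring
  rw [mul_one] at lim
  exact anti.le_of_tendsto lim j

-- The left side increases in `j` and tends to the right side.
open Real.Wallis in
theorem wallis_lower (j : ℕ) : W (j + 1) ^ 2 *
    ((2 * j + 3) ^ 2 * (4 * j + 3) / ((2 * j + 2) ^ 2 * (4 * j + 5))) ≤ (Real.pi / 2) ^ 2 := by
  have mono : Monotone fun j : ℕ => W (j + 1) ^ 2 *
      ((2 * j + 3) ^ 2 * (4 * j + 3) / ((2 * j + 2) ^ 2 * (4 * j + 5)) : ℝ) := by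
    refine monotone_nat_of_le_succ fun n => ?_
    have hW := W_pos (n + 1)
    rw [W_succ (n + 1), mul_pow, mul_assoc]
    refine mul_le_mul_of_nonneg_left ?_ (by positivity)
    push_cast
    rw [div_mul_div_comm, div_pow, div_mul_div_comm,
      div_le_div_iff₀ (by positivity) (by positivity)]
    have hn : (0 : ℝ) ≤ n := by positivity
    generalize (n : ℝ) = x at *
    rw [← sub_nonneg]
    ring_nf
    positivity
  have lim : Tendsto (fun j : ℕ => W (j + 1) ^ 2 *
      ((2 * j + 3) ^ 2 * (4 * j + 3) / ((2 * j + 2) ^ 2 * (4 * j + 5)) : ℝ)) atTop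
      (𝓝 ((Real.pi / 2) ^ 2 * ((1 + 1 * 0) ^ 2 * (1 - 2 * 0)))) := by
    refine ((tendsto_W_nhds_pi_div_two.comp (tendsto_add_atTop_nat 1)).pow 2).mul ?_
    have z : ∀ a b : ℝ, 1 ≤ a → 1 ≤ b →
        Tendsto (fun n : ℕ => 1 / (a * (n : ℝ) + b)) atTop (𝓝 0) := by
      intro a b ha hb
      refine squeeze_zero (fun n => by positivity) (fun n => ?_) tendsto_one_div_add_atTop_nhds_zero_nat
      gcongr
      have : (0 : ℝ) ≤ n := by positivity
      nlinarith
    have z1 := z 2 2 (by norm_num) (by norm_num)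
    have z2 := z 4 5 (by norm_num) (by norm_num)
    refine (((tendsto_const_nhds (x := (1 : ℝ))).add
      ((tendsto_const_nhds (x := (1 : ℝ))).mul z1)).pow 2 |>.mul
      ((tendsto_const_nhds (x := (1 : ℝ))).sub ((tendsto_const_nhds (x := (2 : ℝ))).mul z2))).congr
        fun n => ?_
    field_simp
    ring
  simp only [mul_zero, add_zero, sub_zero, one_pow, mul_one] at lim
  exact mono.ge_of_tendsto lim j

-- The left side is `refH l j / refA l j`. Its ratio at successive `j` is the one bounded in
-- `chebCoeff_ratio_le`, so it stays below the product of the limiting ratios, which is a Wallis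
-- expression.
open Real.Wallis in
theorem refH_sq_le {l j : ℕ} (hj : j < l) :
    Real.pi ^ 2 * refH l j ^ 2 * chebCoeff l (2 * j + 1) ≤
      (Real.pi / 2) ^ 2 / (W j ^ 2 * ((4 * j + 3) / (4 * j + 1))) := by
  induction j with
  | zero =>
    have hl : (1 : ℝ) ≤ l := by exact_mod_cast hj
    simp only [refH, chebCoeff, W, Finset.prod_range_zero]
    norm_num
    have : Real.pi ^ 2 * ((l : ℝ)⁻¹ * (1 / 2)) ^ 2 * ((4 * (l : ℝ) ^ 2 - 1) / 12) =
      Real.pi ^ 2 / 12 * (1 - 1 / (4 * (l : ℝ) ^ 2)) := by field_simp; ring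
    have h2 : Real.pi ^ 2 / 12 * (1 - 1 / (4 * (l : ℝ) ^ 2)) ≤ Real.pi ^ 2 / 12 * 1 := by
      gcongr
      have : 0 ≤ 1 / (4 * (l : ℝ) ^ 2) := by positivity
      linarith
    linarith
  | succ j ih =>
    have ih := ih (by omega)
    have hb := chebCoeff_ratio_le (l := l) (n := 2 * j + 1) (by omega) (by omega)
    have hb1 : 0 < chebCoeff l (2 * j + 1) := chebCoeff_pos (by omega) (by omega)
    have hb2 : 0 < chebCoeff l (2 * j + 2) := chebCoeff_pos (by omega) (by omega)
    have hb3 : 0 < chebCoeff l (2 * j + 3) := chebCoeff_pos (by omega) (by omega)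
    have hh := refH_pos (by omega : j < l)
    have hW := W_pos j
    have := mul_le_mul ih hb (by positivity) (by positivity)
    rw [show 2 * j + 1 + 2 = 2 * (j + 1) + 1 by ring, show 2 * j + 1 + 1 = 2 * j + 2 by ring,
      legCoeff_odd, legCoeff_odd, legCoeff_even] at this
    refine (le_of_eq ?_).trans (this.trans (le_of_eq ?_))
    · simp only [refH]
      field_simp
    · rw [W_succ]
      push_cast
      field_simp
      ring

-- The right side is `refH l (j + 1) / refA l j`. Here the ratio at successive `j` is the reciprocal
-- one, so the bound runs the other way.
open Real.Wallis in
theorem le_refH_sq {l j : ℕ} (hj : j + 1 < l) :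
    (Real.pi / 2) ^ 2 / (W (j + 1) ^ 2 *
      ((2 * j + 3) ^ 2 * (4 * j + 3) / ((2 * j + 2) ^ 2 * (4 * j + 5)))) ≤
    Real.pi ^ 2 * refH l (j + 1) ^ 2 * chebCoeff l (2 * j + 2) := by
  induction j with
  | zero =>
    have hl : (2 : ℝ) ≤ l := by exact_mod_cast hj
    have hl4 : 0 < 4 * (l : ℝ) ^ 2 - 4 := by nlinarith
    have hb2 : 0 < chebCoeff l 2 := chebCoeff_pos (by omega) (by omega)
    have e : Real.pi ^ 2 * refH l (0 + 1) ^ 2 * chebCoeff l (2 * 0 + 2) =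
        Real.pi ^ 2 * (1 / (2 * l)) ^ 2 * chebCoeff l 1 ^ 2 / chebCoeff l 2 := by
      simp only [refH, mul_zero, zero_add]
      field_simp
    have e1 : chebCoeff l 1 = (4 * (l : ℝ) ^ 2 - 1) / 12 := by simp [chebCoeff]; norm_num
    have e2 : chebCoeff l 2 = (4 * (l : ℝ) ^ 2 - 4) / 15 := by
      simp [chebCoeff]; norm_num; ring
    rw [e, e1, e2]
    simp only [W]
    norm_num
    rw [div_le_div_iff₀ (by positivity) (by positivity)]
    have hp : 0 < Real.pi ^ 2 := by positivity
    field_simp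
    nlinarith
  | succ j ih =>
    have ih := ih (by omega)
    have hb := chebCoeff_ratio_le (l := l) (n := 2 * j + 2) (by omega) (by omega)
    have hb1 : 0 < chebCoeff l (2 * j + 2) := chebCoeff_pos (by omega) (by omega)
    have hb2 : 0 < chebCoeff l (2 * j + 3) := chebCoeff_pos (by omega) (by omega)
    have hb3 : 0 < chebCoeff l (2 * j + 4) := chebCoeff_pos (by omega) (by omega)
    have hh := refH_pos (by omega : j + 1 < l)
    have hW := W_pos (j + 1)
    have l1 := legCoeff_pos (by omega : 0 < 2 * j + 2)
    have l2 := legCoeff_pos (by omega : 0 < 2 * j + 2 + 1)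
    have l3 := legCoeff_pos (by omega : 0 < 2 * j + 2 + 2)
    have hb' := one_div_le_one_div_of_le (by positivity) hb
    have := mul_le_mul ih hb' (by positivity) (by positivity)
    rw [show 2 * j + 2 + 2 = 2 * (j + 1) + 2 by ring, show 2 * j + 2 + 1 = 2 * (j + 1) + 1 by ring,
      legCoeff_odd, legCoeff_even, legCoeff_even] at this
    refine (le_of_eq ?_).trans (this.trans (le_of_eq ?_))
    · rw [W_succ (j + 1)]
      push_cast
      field_simp
      ring
    · have : refH l (j + 1 + 1) = refH l (j + 1) * (chebCoeff l (2 * (j + 1) + 1) /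
        chebCoeff l (2 * (j + 1) + 2)) := rfl
      rw [this]
      field_simp

theorem refH_le_refA {l j : ℕ} (hj : j < l) : refH l j ≤ refA l j := by
  have h1 := refH_sq_le hj
  have h2 := div_le_one_of_le₀ (wallis_upper j)
    (by have := Real.Wallis.W_pos j; positivity)
  have hb : 0 < chebCoeff l (2 * j + 1) := chebCoeff_pos (by omega) (by omega)
  have hh := refH_pos hj
  unfold refA
  rw [le_div_iff₀ (by positivity)]
  linarith

theorem refA_le_refH {l j : ℕ} (hj : j + 1 < l) : refA l j ≤ refH l (j + 1) := by
  have h1 := le_refH_sq hj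
  have h2 := (one_le_div (by have := Real.Wallis.W_pos (j + 1); positivity)).2 (wallis_lower j)
  have hb : 0 < chebCoeff l (2 * j + 1) := chebCoeff_pos (by omega) (by omega)
  have hb2 : 0 < chebCoeff l (2 * j + 2) := chebCoeff_pos (by omega) (by omega)
  have hh := refH_pos (by omega : j < l)
  have e : Real.pi ^ 2 * refH l (j + 1) ^ 2 * chebCoeff l (2 * j + 2) =
      refH l (j + 1) * (Real.pi ^ 2 * chebCoeff l (2 * j + 1) * refH l j) := by
    simp only [refH]; field_simp
  unfold refA
  rw [div_le_iff₀ (by positivity)]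
  linarith

/-- Interlacing of the steps makes the primary steps increase, so bounding the last one bounds the
mesh. -/
theorem refA_le_last {l j : ℕ} (hj : j < l) : refA l j ≤ refA l (l - 1) := by
  have : ∀ d, j + d < l → refA l j ≤ refA l (j + d) := by
    intro d
    induction d with
    | zero => intro _; exact le_rfl
    | succ d ih =>
      intro hd
      exact (ih (by omega)).trans ((refA_le_refH (by omega)).trans (refH_le_refA hd))
  have h := this (l - 1 - j) (by omega)
  rwa [show j + (l - 1 - j) = l - 1 by omega] at h

/-- The products `refA j * refH j` and `refA j * refH (j + 1)` are explicit, so one interlacing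
inequality bounds the last dual step from below and hence the last primary step from above. Near
index `2 * l` the coefficients `chebCoeff l` are of order `l`, which gives the rate. -/
theorem refA_last_sq_le {m : ℕ} : refA (m + 2) (m + 1) ^ 2 ≤ 2 / (m + 2 : ℝ) := by
  set l := m + 2 with hl
  have h1 := refA_le_refH (l := l) (j := m) (by omega)
  have hb1 : 0 < chebCoeff l (2 * m + 1) := chebCoeff_pos (by omega) (by omega)
  have hb2 : 0 < chebCoeff l (2 * m + 2) := chebCoeff_pos (by omega) (by omega)
  have hb3 : 0 < chebCoeff l (2 * (m + 1) + 1) := chebCoeff_pos (by omega) (by omega)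
  have hh := refH_pos (by omega : m < l)
  have hh1 := refH_pos (by omega : m + 1 < l)
  have e : refA l m * refH l (m + 1) = 1 / (Real.pi ^ 2 * chebCoeff l (2 * m + 2)) := by
    simp only [refA, refH]; field_simp
  have h2 : 1 / (Real.pi ^ 2 * chebCoeff l (2 * m + 2)) ≤ refH l (m + 1) ^ 2 := by
    rw [← e, sq]; gcongr
  have h3 : refA l (m + 1) ^ 2 = 1 / (Real.pi ^ 2 * chebCoeff l (2 * (m + 1) + 1)) ^ 2 /
      refH l (m + 1) ^ 2 := by
    simp only [refA]; field_simp
  have hpi : 0 < Real.pi := Real.pi_pos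
  have h4 : refA l (m + 1) ^ 2 ≤ 1 / (Real.pi ^ 2 * chebCoeff l (2 * (m + 1) + 1)) ^ 2 /
      (1 / (Real.pi ^ 2 * chebCoeff l (2 * m + 2))) := by
    rw [h3]; gcongr
  have hm : (0 : ℝ) ≤ m := by positivity
  have c2 : chebCoeff l (2 * m + 2) ≤ (2 / 3) * (m + 2) := by
    rw [chebCoeff_eq, legCoeff_even, hl]
    push_cast
    rw [div_mul_eq_mul_div, div_div, div_le_iff₀ (by positivity)]
    rw [← sub_nonneg]
    ring_nf
    positivity
  have c3 : 3 * (m + 2 : ℝ) / 16 ≤ chebCoeff l (2 * (m + 1) + 1) := by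
    rw [chebCoeff_eq, legCoeff_odd, hl]
    push_cast
    rw [div_mul_eq_mul_div, div_div, div_le_div_iff₀ (by positivity) (by positivity)]
    rw [← sub_nonneg]
    ring_nf
    positivity
  refine h4.trans ?_
  have e5 : 1 / (Real.pi ^ 2 * chebCoeff l (2 * (m + 1) + 1)) ^ 2 /
      (1 / (Real.pi ^ 2 * chebCoeff l (2 * m + 2))) =
        chebCoeff l (2 * m + 2) / (Real.pi ^ 2 * chebCoeff l (2 * (m + 1) + 1) ^ 2) := by
    field_simp
  rw [e5, div_le_div_iff₀ (by positivity) (by positivity)]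
  have hpi2 : 9.8 ≤ Real.pi ^ 2 := by nlinarith [Real.pi_gt_d4]
  have s : (9 / 256) * (m + 2 : ℝ) ^ 2 ≤ chebCoeff l (2 * (m + 1) + 1) ^ 2 := by
    calc (9 / 256) * (m + 2 : ℝ) ^ 2 = (3 * (m + 2 : ℝ) / 16) ^ 2 := by ring
      _ ≤ _ := by gcongr
  have s1 : 9.8 * ((9 / 256) * (m + 2 : ℝ) ^ 2) ≤
      Real.pi ^ 2 * chebCoeff l (2 * (m + 1) + 1) ^ 2 := by gcongr
  have s2 := mul_le_mul_of_nonneg_right c2 (by positivity : (0 : ℝ) ≤ m + 2)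
  nlinarith


/-! ### Solutions of `y'' = q y`; the conductivity as a square. -/

/-- The solution of `y'' = q y`, `y 0 = 1`, `y' 0 = 0`. -/
noncomputable def genCos (q x : ℝ) : ℝ :=
  if 0 ≤ q then Real.cosh (√q * x) else Real.cos (√(-q) * x)

/-- The solution of `y'' = q y`, `y 0 = 0`, `y' 0 = 1`. -/
noncomputable def genSin (q x : ℝ) : ℝ :=
  if q = 0 then x else if 0 ≤ q then Real.sinh (√q * x) / √q else Real.sin (√(-q) * x) / √(-q)

theorem sigmaQ_eq_genCos_sq (q x : ℝ) : sigmaQ q x = genCos q x ^ 2 := by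
  unfold sigmaQ genCos
  split_ifs
  · rw [Real.cosh_eq]; ring
  · rfl

/-- Makes the reference problem an instance of the results for `sigmaQ`. -/
theorem sigmaQ_zero : sigmaQ 0 = sigmaRef := by
  ext x; simp [sigmaQ_eq_genCos_sq, genCos, sigmaRef]

@[simp] theorem genCos_zero (q : ℝ) : genCos q 0 = 1 := by simp [genCos]
@[simp] theorem genSin_zero (q : ℝ) : genSin q 0 = 0 := by simp [genSin]

theorem hasDerivAt_genCos (q x : ℝ) : HasDerivAt (genCos q) (q * genSin q x) x := by
  unfold genCos genSin
  rcases lt_trichotomy q 0 with h | h | h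
  · simp only [not_le.2 h, if_false, h.ne]
    have h' : 0 < √(-q) := Real.sqrt_pos.2 (by linarith)
    have := ((hasDerivAt_id x).const_mul (√(-q))).cos
    refine this.congr_deriv ?_
    have e : q = -(√(-q) * √(-q)) := by rw [Real.mul_self_sqrt (by linarith)]; ring
    generalize √(-q) = s at *
    rw [e]
    simp only [id]
    field_simp
  · subst h
    simpa using hasDerivAt_const x (1 : ℝ)
  · simp only [h.le, if_true, h.ne', if_false]
    have h' : 0 < √q := Real.sqrt_pos.2 h
    have := ((hasDerivAt_id x).const_mul (√q)).cosh
    refine this.congr_deriv ?_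
    have e : q = √q * √q := by rw [Real.mul_self_sqrt h.le]
    generalize √q = s at *
    rw [e]
    simp only [id]
    field_simp

theorem hasDerivAt_genSin (q x : ℝ) : HasDerivAt (genSin q) (genCos q x) x := by
  unfold genCos genSin
  rcases lt_trichotomy q 0 with h | h | h
  · simp only [not_le.2 h, if_false, h.ne]
    have h' : 0 < √(-q) := Real.sqrt_pos.2 (by linarith)
    have := (((hasDerivAt_id x).const_mul (√(-q))).sin).div_const (√(-q))
    refine this.congr_deriv ?_
    simp only [id]
    field_simp
  · subst h
    simpa using hasDerivAt_id' x
  · simp only [h.le, if_true, h.ne', if_false]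
    have h' : 0 < √q := Real.sqrt_pos.2 h
    have := (((hasDerivAt_id x).const_mul (√q)).sinh).div_const (√q)
    refine this.congr_deriv ?_
    simp only [id]
    field_simp

theorem continuous_genCos (q : ℝ) : Continuous (genCos q) :=
  continuous_iff_continuousAt.2 fun x => (hasDerivAt_genCos q x).continuousAt

theorem continuous_genSin (q : ℝ) : Continuous (genSin q) :=
  continuous_iff_continuousAt.2 fun x => (hasDerivAt_genSin q x).continuousAt

theorem genCos_sq_sub (q x : ℝ) : genCos q x ^ 2 - q * genSin q x ^ 2 = 1 := by
  have hd : ∀ x, HasDerivAt (fun x => genCos q x ^ 2 - q * genSin q x ^ 2) 0 x := by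
    intro x
    refine (((hasDerivAt_genCos q x).pow 2).sub
      (((hasDerivAt_genSin q x).pow 2).const_mul q)).congr_deriv ?_
    simp only [Nat.cast_ofNat]
    ring
  have := is_const_of_deriv_eq_zero (fun x => (hd x).differentiableAt) (fun x => (hd x).deriv) x 0
  simpa using this

theorem genCos_neg_sq (d x : ℝ) : genCos (-d ^ 2) x = Real.cos (d * x) := by
  unfold genCos
  split_ifs with h
  · have : d = 0 := by nlinarith [sq_nonneg d]
    simp [this]
  · rw [neg_neg, Real.sqrt_sq_eq_abs]
    rcases abs_choice d with e | e <;> rw [e]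
    rw [neg_mul, Real.cos_neg]

theorem genCos_one_eq_zero_iff (q : ℝ) :
    genCos q 1 = 0 ↔ ∃ j : ℕ, q = -(Real.pi * (j + 1 / 2)) ^ 2 := by
  constructor
  · intro h
    by_cases hq : 0 ≤ q
    · rw [genCos, if_pos hq] at h
      exact absurd h (Real.cosh_pos _).ne'
    · rw [genCos, if_neg hq, Real.cos_eq_zero_iff] at h
      obtain ⟨k, hk⟩ := h
      have h0 : 0 ≤ √(-q) := Real.sqrt_nonneg _
      have hk0 : 0 ≤ k := by
        by_contra hc
        have : (k : ℝ) ≤ -1 := by exact_mod_cast (by omega : k ≤ -1)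
        nlinarith [Real.pi_pos]
      obtain ⟨n, rfl⟩ := Int.eq_ofNat_of_zero_le hk0
      refine ⟨n, ?_⟩
      have e : q = -(√(-q)) ^ 2 := by rw [Real.sq_sqrt (by linarith)]; ring
      rw [e]
      rw [mul_one] at hk
      rw [hk]
      push_cast
      ring
  · rintro ⟨j, rfl⟩
    rw [genCos_neg_sq, Real.cos_eq_zero_iff]
    exact ⟨j, by push_cast; ring⟩

/-- For negative `q` the hypothesis says `√(-q) * b < π / 2`. A general `b` is kept because dual
nodes may lie slightly beyond `1`. -/
theorem genCos_pos {q b x : ℝ} (hq : -(Real.pi ^ 2 / 4) < q * b ^ 2) (hx : 0 ≤ x) (hxb : x ≤ b) :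
    0 < genCos q x := by
  unfold genCos
  split_ifs with h
  · exact Real.cosh_pos _
  · have h0 : 0 ≤ √(-q) := Real.sqrt_nonneg _
    have h1 : √(-q) * b < Real.pi / 2 := by
      refine lt_of_pow_lt_pow_left₀ 2 (by positivity) ?_
      rw [mul_pow, Real.sq_sqrt (by linarith)]
      nlinarith
    apply Real.cos_pos_of_mem_Ioo
    constructor
    · have : 0 ≤ √(-q) * x := by positivity
      linarith [Real.pi_pos]
    · exact lt_of_le_of_lt (by gcongr) h1

theorem genCos_pos_of_mem {q x : ℝ} (hq : -(Real.pi ^ 2 / 4) < q) (hx : x ∈ Set.Icc (0 : ℝ) 1) :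
    0 < genCos q x := genCos_pos (b := 1) (by linarith) hx.1 hx.2

theorem hasDerivAt_genSin_div {q x : ℝ} (h : genCos q x ≠ 0) :
    HasDerivAt (fun x => genSin q x / genCos q x) (1 / sigmaQ q x) x := by
  refine ((hasDerivAt_genSin q x).div (hasDerivAt_genCos q x) h).congr_deriv ?_
  rw [sigmaQ_eq_genCos_sq]
  congr 1
  linear_combination genCos_sq_sub q x

/-! ### Spectral data of `sigmaQ q` and Bessel's inequality. -/

section Modes

variable {q : ℝ}

/-- The flux `σ y'` of the function `y = genCos k / genCos q`. -/
noncomputable def modeFlux (q k x : ℝ) : ℝ :=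
  k * genSin k x * genCos q x - genCos k x * (q * genSin q x)

theorem hasDerivAt_mode {k x : ℝ} (h : genCos q x ≠ 0) :
    HasDerivAt (fun x => genCos k x / genCos q x) (modeFlux q k x / sigmaQ q x) x := by
  refine ((hasDerivAt_genCos k x).div (hasDerivAt_genCos q x) h).congr_deriv ?_
  rw [sigmaQ_eq_genCos_sq, modeFlux]

theorem hasDerivAt_modeFlux (k x : ℝ) :
    HasDerivAt (modeFlux q k) ((k - q) * (genCos k x * genCos q x)) x := by
  refine ((((hasDerivAt_genSin k x).const_mul k).mul (hasDerivAt_genCos q x)).sub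
    ((hasDerivAt_genCos k x).mul ((hasDerivAt_genSin q x).const_mul q))).congr_deriv ?_
  ring

@[simp] theorem modeFlux_zero (k : ℝ) : modeFlux q k 0 = 0 := by simp [modeFlux]

theorem isModeSolution_mode (hq : -(Real.pi ^ 2 / 4) < q) {lam : ℝ}
    (h1 : genCos (q + lam) 1 = 0) (r : ℝ) :
    IsModeSolution (sigmaQ q) lam (fun x => r * (genCos (q + lam) x / genCos q x)) := by
  refine ⟨fun x => r * modeFlux q (q + lam) x, fun x hx => ?_, fun x hx => ?_, by simp, by simp [h1]⟩
  · have := (hasDerivAt_mode (k := q + lam) (genCos_pos_of_mem hq hx).ne').const_mul r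
    exact (this.congr_deriv (by ring)).hasDerivWithinAt
  · have := (hasDerivAt_modeFlux (q := q) (q + lam) x).const_mul r
    refine (this.congr_deriv ?_).hasDerivWithinAt
    have := (genCos_pos_of_mem hq hx).ne'
    rw [sigmaQ_eq_genCos_sq]
    field_simp
    ring

theorem eq_of_hasDerivWithinAt_zero {f : ℝ → ℝ}
    (h : ∀ x ∈ Set.Icc (0 : ℝ) 1, HasDerivWithinAt f 0 (Set.Icc 0 1) x) :
    ∀ x ∈ Set.Icc (0 : ℝ) 1, f x = f 0 :=
  constant_of_has_deriv_right_zero (fun x hx => (h x hx).continuousWithinAt) fun x hx =>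
    (h x (Set.Ico_subset_Icc_self hx)).mono_of_mem_nhdsWithin (Icc_mem_nhdsGE_of_mem hx)

/-- The Liouville transform `u = √σ y` satisfies `u'' = k u` with `u' 0 = 0`. Its Wronskians with
`genSin k` and `genCos k` are constant (`i1`, `i2`), and solving these two equations for `u` gives
the claim. -/
theorem IsModeSolution.eq_mode (hq : -(Real.pi ^ 2 / 4) < q) {lam : ℝ} {y : ℝ → ℝ}
    (H : IsModeSolution (sigmaQ q) lam y) :
    ∀ x ∈ Set.Icc (0 : ℝ) 1, genCos q x * y x = y 0 * genCos (q + lam) x := by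
  obtain ⟨p, hy, hp, hp0, -⟩ := H
  set k := q + lam with hk
  set u : ℝ → ℝ := fun x => genCos q x * y x with hu
  set v : ℝ → ℝ := fun x => q * genSin q x * y x + p x / genCos q x with hv
  have du : ∀ x ∈ Set.Icc (0 : ℝ) 1, HasDerivWithinAt u (v x) (Set.Icc 0 1) x := by
    intro x hx
    have hc := (genCos_pos_of_mem hq hx).ne'
    refine ((hasDerivAt_genCos q x).hasDerivWithinAt.mul (hy x hx)).congr_deriv ?_
    simp only [hv, sigmaQ_eq_genCos_sq]
    field_simp
  have dv : ∀ x ∈ Set.Icc (0 : ℝ) 1, HasDerivWithinAt v (k * u x) (Set.Icc 0 1) x := by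
    intro x hx
    have hc := (genCos_pos_of_mem hq hx).ne'
    refine ((((hasDerivAt_genSin q x).const_mul q).hasDerivWithinAt.mul (hy x hx)).add
      ((hp x hx).div (hasDerivAt_genCos q x).hasDerivWithinAt hc)).congr_deriv ?_
    simp only [hu, hk, sigmaQ_eq_genCos_sq]
    field_simp
    ring
  have i1 : ∀ x ∈ Set.Icc (0 : ℝ) 1, u x * genCos k x - v x * genSin k x = y 0 := by
    intro x hx
    have := eq_of_hasDerivWithinAt_zero (f := fun x => u x * genCos k x - v x * genSin k x)
      (fun x hx => (((du x hx).mul (hasDerivAt_genCos k x).hasDerivWithinAt).sub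
        ((dv x hx).mul (hasDerivAt_genSin k x).hasDerivWithinAt)).congr_deriv (by ring)) x hx
    simpa [hu] using this
  have i2 : ∀ x ∈ Set.Icc (0 : ℝ) 1, v x * genCos k x - k * (u x * genSin k x) = 0 := by
    intro x hx
    have := eq_of_hasDerivWithinAt_zero (f := fun x => v x * genCos k x - k * (u x * genSin k x))
      (fun x hx => (((dv x hx).mul (hasDerivAt_genCos k x).hasDerivWithinAt).sub
        (((du x hx).mul (hasDerivAt_genSin k x).hasDerivWithinAt).const_mul k)).congr_deriv
          (by ring)) x hx
    simpa [hv, hp0] using this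
  intro x hx
  have := genCos_sq_sub k x
  linear_combination genCos k x * i1 x hx + genSin k x * i2 x hx - u x * this

theorem isModeEigenvalue_iff (hq : -(Real.pi ^ 2 / 4) < q) (lam : ℝ) :
    IsModeEigenvalue (sigmaQ q) lam ↔ ∃ j : ℕ, q + lam = -(Real.pi * (j + 1 / 2)) ^ 2 := by
  rw [← genCos_one_eq_zero_iff]
  constructor
  · rintro ⟨y, hy, x, hx, hyx⟩
    have h := hy.eq_mode hq
    have h1 := h 1 (by simp)
    obtain ⟨p, -, -, -, y1⟩ := hy
    rw [y1, mul_zero] at h1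
    rcases mul_eq_zero.1 h1.symm with h0 | h0
    · have := h x hx
      rw [h0, zero_mul] at this
      exact absurd this (mul_ne_zero (genCos_pos_of_mem hq hx).ne' hyx)
    · exact h0
  · intro h
    exact ⟨_, isModeSolution_mode hq h 1, 0, by simp, by simp⟩

/-- The square roots of the negatives of the eigenvalues for the conductivity `sigmaQ q`. -/
noncomputable def modeFreq (q : ℝ) (j : ℕ) : ℝ := √((Real.pi * (j + 1 / 2)) ^ 2 + q)

theorem freq_sq_add_pos (hq : -(Real.pi ^ 2 / 4) < q) (j : ℕ) :
    0 < (Real.pi * (j + 1 / 2)) ^ 2 + q := by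
  have h0 : (0 : ℝ) ≤ j := by positivity
  have : (Real.pi * (1 / 2)) ^ 2 ≤ (Real.pi * (j + 1 / 2)) ^ 2 := by gcongr; linarith
  nlinarith

theorem modeFreq_sq (hq : -(Real.pi ^ 2 / 4) < q) (j : ℕ) :
    modeFreq q j ^ 2 = (Real.pi * (j + 1 / 2)) ^ 2 + q :=
  Real.sq_sqrt (freq_sq_add_pos hq j).le

theorem integral_cos_pi_mul (n : ℤ) :
    ∫ x in (0 : ℝ)..1, Real.cos (Real.pi * n * x) = if n = 0 then 1 else 0 := by
  split_ifs with h
  · simp [h]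
  · have hn : Real.pi * n ≠ 0 := mul_ne_zero Real.pi_pos.ne' (by exact_mod_cast h)
    rw [intervalIntegral.integral_comp_mul_left _ hn, integral_cos]
    simp [mul_comm Real.pi, Real.sin_int_mul_pi]

theorem integral_cos_mul_cos (j k : ℕ) :
    ∫ x in (0 : ℝ)..1, Real.cos (Real.pi * (j + 1 / 2) * x) * Real.cos (Real.pi * (k + 1 / 2) * x) =
      if j = k then 1 / 2 else 0 := by
  have e : ∀ x : ℝ, Real.cos (Real.pi * (j + 1 / 2) * x) * Real.cos (Real.pi * (k + 1 / 2) * x) =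
      1 / 2 * Real.cos (Real.pi * ((j - k : ℤ) : ℝ) * x) +
      1 / 2 * Real.cos (Real.pi * ((j + k + 1 : ℤ) : ℝ) * x) := by
    intro x
    have h1 : Real.pi * ((j - k : ℤ) : ℝ) * x =
        Real.pi * (j + 1 / 2) * x - Real.pi * (k + 1 / 2) * x := by push_cast; ring
    have h2 : Real.pi * ((j + k + 1 : ℤ) : ℝ) * x =
        Real.pi * (j + 1 / 2) * x + Real.pi * (k + 1 / 2) * x := by push_cast; ring
    rw [h1, h2, Real.cos_sub, Real.cos_add]
    ring
  simp only [e]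
  rw [intervalIntegral.integral_add
    (Continuous.intervalIntegrable (by fun_prop) _ _)
    (Continuous.intervalIntegrable (by fun_prop) _ _),
    intervalIntegral.integral_const_mul, intervalIntegral.integral_const_mul,
    integral_cos_pi_mul, integral_cos_pi_mul, if_neg (by omega : ¬ ((j : ℤ) + k + 1 = 0))]
  by_cases h : j = k
  · simp [h]
  · rw [if_neg h, if_neg (by omega)]; simp

theorem integral_mode_sq (hq : -(Real.pi ^ 2 / 4) < q) {j : ℕ} {y : ℝ → ℝ}
    (H : IsModeSolution (sigmaQ q) (-(modeFreq q j) ^ 2) y) :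
    ∫ x in (0 : ℝ)..1, y x ^ 2 * sigmaQ q x = y 0 ^ 2 / 2 := by
  have h := H.eq_mode hq
  have e : ∀ x ∈ Set.uIcc (0 : ℝ) 1, y x ^ 2 * sigmaQ q x = y 0 ^ 2 *
      (Real.cos (Real.pi * (j + 1 / 2) * x) * Real.cos (Real.pi * (j + 1 / 2) * x)) := by
    intro x hx
    rw [Set.uIcc_of_le zero_le_one] at hx
    have := h x hx
    rw [show q + -(modeFreq q j) ^ 2 = -(Real.pi * (j + 1 / 2)) ^ 2 by
      rw [modeFreq_sq hq]; ring, genCos_neg_sq] at this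
    rw [sigmaQ_eq_genCos_sq, ← mul_pow, mul_comm (y x), this]
    ring
  rw [intervalIntegral.integral_congr e, intervalIntegral.integral_const_mul,
    integral_cos_mul_cos, if_pos rfl]
  ring

/-- The normalized modes are `√2 * cos (π (j + 1/2) x) / √σ`, and `√σ = 1` at the origin, so the
weights do not depend on `q`. -/
theorem isSpectralData_modeFreq (hq : -(Real.pi ^ 2 / 4) < q) :
    IsSpectralData (sigmaQ q) (modeFreq q) (fun _ => 2) := by
  have ev : ∀ j, genCos (q + -(modeFreq q j) ^ 2) 1 = 0 := fun j =>
    (genCos_one_eq_zero_iff _).2 ⟨j, by rw [modeFreq_sq hq]; ring⟩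
  refine ⟨fun j => Real.sqrt_pos.2 (freq_sq_add_pos hq j), fun i j hij => ?_, fun lam => ?_,
    fun j => ?_⟩
  · refine Real.sqrt_lt_sqrt (freq_sq_add_pos hq i).le ?_
    have : (i : ℝ) < j := by exact_mod_cast hij
    have := Real.pi_pos
    gcongr
  · rw [isModeEigenvalue_iff hq]
    refine exists_congr fun j => ?_
    rw [modeFreq_sq hq]
    constructor <;> intro h <;> linarith
  · refine ⟨_, isModeSolution_mode hq (ev j) √2, ?_, ?_⟩
    · rw [integral_mode_sq hq (isModeSolution_mode hq (ev j) √2)]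
      simp
    · simp

/-- A strictly increasing sequence is determined by its range, here the set of square roots of the
negated eigenvalues. -/
theorem IsSpectralData.eq (hq : -(Real.pi ^ 2 / 4) < q) {δ ξ : ℕ → ℝ}
    (H : IsSpectralData (sigmaQ q) δ ξ) : δ = modeFreq q ∧ ξ = fun _ => 2 := by
  have H' := isSpectralData_modeFreq hq
  have hδ : δ = modeFreq q := by
    refine (H.strictMono.range_inj H'.strictMono).1 ?_
    have key : ∀ {δ ξ δ' ξ' : ℕ → ℝ}, IsSpectralData (sigmaQ q) δ ξ →
        IsSpectralData (sigmaQ q) δ' ξ' → Set.range δ ⊆ Set.range δ' := by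
      rintro δ ξ δ' ξ' h h' _ ⟨j, rfl⟩
      obtain ⟨i, hi⟩ := (h'.eigenvalue_iff _).1 ((h.eigenvalue_iff _).2 ⟨j, rfl⟩)
      refine ⟨i, ?_⟩
      have := h.pos j
      have := h'.pos i
      exact (pow_left_inj₀ (by positivity) (by positivity) two_ne_zero).1 (neg_injective hi).symm
    exact (key H H').antisymm (key H' H)
  refine ⟨hδ, funext fun j => ?_⟩
  obtain ⟨y, hy, hn, hx⟩ := H.weight j
  rw [hδ] at hy
  rw [integral_mode_sq hq hy] at hn
  rw [hx]
  linarith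

/-- Bessel's inequality for `1 / √σ` and the normalized fluxes of the modes. -/
theorem sum_le_genSin_div (hq : -(Real.pi ^ 2 / 4) < q) (l : ℕ) :
    ∑ k ∈ Finset.range l, 2 / ((Real.pi * (k + 1 / 2)) ^ 2 + q) ≤ genSin q 1 / genCos q 1 := by
  set c : ℕ → ℝ := fun k => 2 / ((Real.pi * (k + 1 / 2)) ^ 2 + q) with hc
  set κ : ℕ → ℝ := fun k => -(Real.pi * (k + 1 / 2)) ^ 2 with hκ
  set w : ℝ → ℝ := fun x => ∑ k ∈ Finset.range l, c k * (genCos (κ k) x / genCos q x) with hw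
  set P : ℝ → ℝ := fun x => ∑ k ∈ Finset.range l, c k * modeFlux q (κ k) x with hP
  set r : ℝ → ℝ := fun x => 2 * ((∑ k ∈ Finset.range l, genCos (κ k) x) *
    ∑ m ∈ Finset.range l, c m * genCos (κ m) x) with hr
  have dw : ∀ x ∈ Set.Icc (0 : ℝ) 1, HasDerivAt w (P x / sigmaQ q x) x := by
    intro x hx
    have hne := (genCos_pos_of_mem hq hx).ne'
    refine (HasDerivAt.fun_sum fun k _ => (hasDerivAt_mode (k := κ k) hne).const_mul
      (c k)).congr_deriv ?_
    rw [hP, Finset.sum_div]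
    exact Finset.sum_congr rfl fun k _ => by ring
  have dP : ∀ x ∈ Set.Icc (0 : ℝ) 1,
      HasDerivAt P (-(2 * (∑ k ∈ Finset.range l, genCos (κ k) x) * genCos q x)) x := by
    intro x _
    refine (HasDerivAt.fun_sum fun k _ => (hasDerivAt_modeFlux (q := q) (κ k) x).const_mul
      (c k)).congr_deriv ?_
    rw [Finset.mul_sum, Finset.sum_mul, ← Finset.sum_neg_distrib]
    refine Finset.sum_congr rfl fun k _ => ?_
    have : c k * (κ k - q) = -2 := by
      have := (freq_sq_add_pos hq k).ne'
      simp only [hc, hκ]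
      rw [div_mul_eq_mul_div, div_eq_iff this]; ring
    linear_combination genCos (κ k) x * genCos q x * this
  -- Integration by parts in differentiated form. The derivative is the square `(1 + P) ^ 2 / σ`
  -- minus `r`, with `∫ r = ∑ c k`, while the increment over `[0, 1]` is `genSin q 1 / genCos q 1 -
  -- 2 * ∑ c k`; nonnegativity of the square is the claim.
  have dΦ : ∀ x ∈ Set.uIcc (0 : ℝ) 1,
      HasDerivAt (fun x => genSin q x / genCos q x + 2 * w x + P x * w x)
        ((1 + P x) ^ 2 / sigmaQ q x - r x) x := by
    intro x hx
    rw [Set.uIcc_of_le zero_le_one] at hx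
    have hne := (genCos_pos_of_mem hq hx).ne'
    refine (((hasDerivAt_genSin_div hne).add ((dw x hx).const_mul 2)).add
      ((dP x hx).mul (dw x hx))).congr_deriv ?_
    have e : genCos q x * w x = ∑ m ∈ Finset.range l, c m * genCos (κ m) x := by
      simp only [hw, Finset.mul_sum]
      exact Finset.sum_congr rfl fun k _ => by field_simp
    simp only [hr]
    rw [← e]
    ring
  have cP : ContinuousOn P (Set.Icc 0 1) := fun x hx =>
    (dP x hx).continuousAt.continuousWithinAt
  have cσ : Continuous (sigmaQ q) := by
    have : sigmaQ q = fun x => genCos q x ^ 2 := funext (sigmaQ_eq_genCos_sq q)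
    rw [this]; exact (continuous_genCos q).pow 2
  have hσ : ∀ x ∈ Set.Icc (0 : ℝ) 1, 0 < sigmaQ q x := fun x hx => by
    rw [sigmaQ_eq_genCos_sq]; exact pow_pos (genCos_pos_of_mem hq hx) 2
  have cos_cont : ∀ k, Continuous (genCos (κ k)) := fun k => continuous_genCos _
  have cr : Continuous r := by simp only [hr]; fun_prop
  have i1 : IntervalIntegrable (fun x => (1 + P x) ^ 2 / sigmaQ q x) MeasureTheory.volume 0 1 := by
    refine ContinuousOn.intervalIntegrable ?_
    rw [Set.uIcc_of_le zero_le_one]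
    exact ((continuousOn_const.add cP).pow 2).div cσ.continuousOn fun x hx => (hσ x hx).ne'
  have ftc := intervalIntegral.integral_eq_sub_of_hasDerivAt dΦ
    (i1.sub (cr.intervalIntegrable 0 1))
  rw [intervalIntegral.integral_sub i1 (cr.intervalIntegrable 0 1)] at ftc
  have nn : 0 ≤ ∫ x in (0 : ℝ)..1, (1 + P x) ^ 2 / sigmaQ q x :=
    intervalIntegral.integral_nonneg zero_le_one fun x hx =>
      div_nonneg (sq_nonneg _) (hσ x hx).le
  have ir : ∫ x in (0 : ℝ)..1, r x = ∑ k ∈ Finset.range l, c k := by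
    have e : ∀ x, r x = ∑ k ∈ Finset.range l, ∑ m ∈ Finset.range l,
        2 * c m * (Real.cos (Real.pi * (k + 1 / 2) * x) * Real.cos (Real.pi * (m + 1 / 2) * x)) := by
      intro x
      simp only [hr, Finset.sum_mul_sum]
      simp only [Finset.mul_sum, hκ, genCos_neg_sq]
      exact Finset.sum_congr rfl fun k _ => Finset.sum_congr rfl fun m _ => by ring
    simp only [e]
    rw [intervalIntegral.integral_finsetSum fun k _ =>
      Continuous.intervalIntegrable (by fun_prop) _ _]
    refine Finset.sum_congr rfl fun k hk => ?_
    rw [intervalIntegral.integral_finsetSum fun k _ =>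
      Continuous.intervalIntegrable (by fun_prop) _ _]
    simp only [intervalIntegral.integral_const_mul, integral_cos_mul_cos]
    rw [Finset.sum_eq_single k (fun m _ hm => by rw [if_neg hm.symm, mul_zero])
      (fun h => absurd hk h), if_pos rfl]
    ring
  have w1 : w 1 = 0 := by
    simp only [hw]
    refine Finset.sum_eq_zero fun k _ => ?_
    rw [(genCos_one_eq_zero_iff (κ k)).2 ⟨k, rfl⟩]; simp
  have w0 : w 0 = ∑ k ∈ Finset.range l, c k := by simp [hw]
  have P0 : P 0 = 0 := by simp [hP]
  rw [ir, w1, w0, P0] at ftc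
  simp only [genSin_zero, zero_div, zero_mul, mul_zero, add_zero, zero_add] at ftc
  linarith

end Modes


/-! ### Convergence of the ladder recursion and of the induced grid. -/

/-- Primary steps `a` and dual steps `h` that interlace, do not exceed `ε`, and have total length
at most one. -/
structure Interlaced (l : ℕ) (a h : ℕ → ℝ) (ε : ℝ) : Prop where
  hpos : ∀ n < l, 0 < h n
  le : ∀ n < l, h n ≤ a n
  le_succ : ∀ n, n + 1 < l → a n ≤ h (n + 1)
  small : ∀ n < l, a n ≤ ε
  total : ∑ p ∈ Finset.range l, a p ≤ 1

namespace Interlaced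

variable {l : ℕ} {a h : ℕ → ℝ} {ε : ℝ}

theorem apos (I : Interlaced l a h ε) {n : ℕ} (hn : n < l) : 0 < a n :=
  (I.hpos n hn).trans_le (I.le n hn)

theorem primary_mem (I : Interlaced l a h ε) {n : ℕ} (hn : n ≤ l) :
    ∑ p ∈ Finset.range n, a p ∈ Set.Icc (0 : ℝ) 1 := by
  refine ⟨Finset.sum_nonneg fun p hp => (I.apos ?_).le, le_trans ?_ I.total⟩
  · have := Finset.mem_range.1 hp; omega
  · exact Finset.sum_le_sum_of_subset_of_nonneg (Finset.range_subset_range.2 hn)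
      fun p hp _ => (I.apos (Finset.mem_range.1 hp)).le

theorem dual_le_primary (I : Interlaced l a h ε) {n : ℕ} (hn : n ≤ l) :
    ∑ p ∈ Finset.range n, h p ≤ ∑ p ∈ Finset.range n, a p :=
  Finset.sum_le_sum fun p hp => I.le p (by have := Finset.mem_range.1 hp; omega)

/-- Together with `dual_le_primary` this places each primary node between two consecutive dual
nodes, which makes the ladder a consistent staggered scheme. -/
theorem primary_le_dual_succ (I : Interlaced l a h ε) {n : ℕ} (hn : n < l) :
    ∑ p ∈ Finset.range n, a p ≤ ∑ p ∈ Finset.range (n + 1), h p := by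
  rw [Finset.sum_range_succ']
  have : ∑ p ∈ Finset.range n, a p ≤ ∑ p ∈ Finset.range n, h (p + 1) :=
    Finset.sum_le_sum fun p hp => I.le_succ p (by have := Finset.mem_range.1 hp; omega)
  linarith [I.hpos 0 (by omega)]

theorem dual_mem (I : Interlaced l a h ε) {n : ℕ} (hn : n ≤ l) :
    ∑ p ∈ Finset.range n, h p ∈ Set.Icc (0 : ℝ) 1 := by
  refine ⟨Finset.sum_nonneg fun p hp => (I.hpos p ?_).le,
    (I.dual_le_primary hn).trans (I.primary_mem hn).2⟩
  have := Finset.mem_range.1 hp; omega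

end Interlaced

theorem abs_sub_sub_mul_le {f f' : ℝ → ℝ} {x y c η : ℝ} (hxy : x ≤ y)
    (hf : ∀ t ∈ Set.Icc x y, HasDerivAt f (f' t) t) (hb : ∀ t ∈ Set.Icc x y, |f' t - c| ≤ η) :
    |f y - f x - (y - x) * c| ≤ η * (y - x) := by
  have := (convex_Icc x y).norm_image_sub_le_of_norm_hasDerivWithin_le
    (f := fun t => f t - t * c) (f' := fun t => f' t - c) (C := η)
    (fun t ht => ((hf t ht).sub ((hasDerivAt_mul_const c))).hasDerivWithinAt)
    (fun t ht => hb t ht) (Set.left_mem_Icc.2 hxy) (Set.right_mem_Icc.2 hxy)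
  rw [Real.norm_eq_abs, Real.norm_eq_abs, abs_of_nonneg (sub_nonneg.2 hxy)] at this
  convert! this using 2
  ring

/-- Uniform convergence of the ladder recursion to the solution of `f'' = q f`. -/
theorem Interlaced.ladder_close {l : ℕ} {a h : ℕ → ℝ} {ε : ℝ} (I : Interlaced l a h ε)
    {q B : ℝ} {f g : ℝ → ℝ} (df : ∀ x, HasDerivAt f (g x) x)
    (dg : ∀ x, HasDerivAt g (q * f x) x)
    (hf : ∀ x ∈ Set.Icc (0 : ℝ) 1, |f x| ≤ B) (hg : ∀ x ∈ Set.Icc (0 : ℝ) 1, |g x| ≤ B)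
    {V F : ℕ → ℝ} (H : IsLadder a h q V F) (hV : V 0 = f 0) (hF : F 0 = g 0) (hε : 0 ≤ ε)
    {n : ℕ} (hn : n ≤ l) :
    |V n - f (∑ p ∈ Finset.range n, a p)| ≤ B * Real.exp (3 * |q| + 1) * ε := by
  have hB : 0 ≤ B := (abs_nonneg _).trans (hf 0 (by simp))
  have lipf : ∀ x ∈ Set.Icc (0 : ℝ) 1, ∀ y ∈ Set.Icc (0 : ℝ) 1, |f y - f x| ≤ B * |y - x| :=
    fun x hx y hy => (convex_Icc (0 : ℝ) 1).norm_image_sub_le_of_norm_hasDerivWithin_le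
      (fun t _ => (df t).hasDerivWithinAt) (fun t ht => hg t ht) hx hy
  have lipg : ∀ x ∈ Set.Icc (0 : ℝ) 1, ∀ y ∈ Set.Icc (0 : ℝ) 1,
      |g y - g x| ≤ |q| * B * |y - x| :=
    fun x hx y hy => (convex_Icc (0 : ℝ) 1).norm_image_sub_le_of_norm_hasDerivWithin_le
      (fun t _ => (dg t).hasDerivWithinAt) (fun t ht => by
        rw [Real.norm_eq_abs, abs_mul]; exact mul_le_mul_of_nonneg_left (hf t ht) (abs_nonneg _))
      hx hy
  -- Discrete Gronwall argument. Potentials are compared at primary nodes and fluxes at dual nodes;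
  -- adding `B * ε` to the error absorbs the local error into the growth factor `1 + (3 * |q| + 1) *
  -- a n`.
  have main : ∀ n ≤ l, |V n - f (∑ p ∈ Finset.range n, a p)| +
      |F n - g (∑ p ∈ Finset.range n, h p)| + B * ε ≤
        B * ε * Real.exp ((3 * |q| + 1) * ∑ p ∈ Finset.range n, a p) := by
    intro n
    induction n with
    | zero => simp [hV, hF]
    | succ n ih =>
      intro hn
      have hn' : n < l := by omega
      have ih := ih hn'.le
      have mx := I.primary_mem hn'.le
      have mx1 := I.primary_mem hn
      have my := I.dual_mem hn'.le
      have my1 := I.dual_mem hn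
      have o1 := I.dual_le_primary hn'.le
      have o2 := I.primary_le_dual_succ hn'
      have o3 := I.dual_le_primary hn
      rw [Finset.sum_range_succ] at mx1 my1 o2 o3
      rw [Finset.sum_range_succ]
      rw [Finset.sum_range_succ _ n] at o3
      rw [Finset.sum_range_succ _ n]
      set x := ∑ p ∈ Finset.range n, a p
      set y := ∑ p ∈ Finset.range n, h p
      have ha := I.apos hn'
      have hh := I.hpos n hn'
      have hha := I.le n hn'
      have hs := I.small n hn'
      have ha1 : a n ≤ 1 := by linarith [mx.1, mx1.2]
      have b1 : |g (y + h n) - g y - (y + h n - y) * (q * f x)| ≤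
          |q| * B * ε * (y + h n - y) := by
        refine abs_sub_sub_mul_le (by linarith) (fun t _ => dg t) fun t ht => ?_
        have ht' : t ∈ Set.Icc (0 : ℝ) 1 := ⟨by linarith [my.1, ht.1], by linarith [my1.2, ht.2]⟩
        rw [← mul_sub, abs_mul, mul_assoc]
        refine mul_le_mul_of_nonneg_left ((lipf x mx t ht').trans ?_) (abs_nonneg _)
        refine mul_le_mul_of_nonneg_left (abs_le.2 ⟨?_, ?_⟩) hB <;> linarith [ht.1, ht.2]
      have b2 : |f (x + a n) - f x - (x + a n - x) * g (y + h n)| ≤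
          |q| * B * ε * (x + a n - x) := by
        refine abs_sub_sub_mul_le (by linarith) (fun t _ => df t) fun t ht => ?_
        have ht' : t ∈ Set.Icc (0 : ℝ) 1 := ⟨by linarith [mx.1, ht.1], by linarith [mx1.2, ht.2]⟩
        refine (lipg _ my1 t ht').trans (mul_le_mul_of_nonneg_left ?_ (by positivity))
        refine abs_le.2 ⟨?_, ?_⟩ <;> linarith [ht.1, ht.2]
      rw [add_sub_cancel_left] at b1 b2
      have e1 : F (n + 1) - g (y + h n) = (F n - g y) + q * h n * (V n - f x) -
          (g (y + h n) - g y - h n * (q * f x)) := by rw [H.flux]; ring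
      have e2 : V (n + 1) - f (x + a n) = (V n - f x) + a n * (F (n + 1) - g (y + h n)) -
          (f (x + a n) - f x - a n * g (y + h n)) := by rw [H.pot]; ring
      have c1 : |F (n + 1) - g (y + h n)| ≤ |F n - g y| + |q| * a n * (|V n - f x| + B * ε) := by
        rw [e1]
        refine (abs_sub _ _).trans ((add_le_add_left (abs_add_le _ _) _).trans ?_)
        rw [abs_mul, abs_mul, abs_of_pos hh]
        have k1 : |q| * h n * |V n - f x| ≤ |q| * a n * |V n - f x| := by gcongr
        have k2 : |q| * B * ε * h n ≤ |q| * B * ε * a n := by gcongr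
        linarith
      have c2 : |V (n + 1) - f (x + a n)| ≤ |V n - f x| +
          a n * |F (n + 1) - g (y + h n)| + |q| * B * ε * a n := by
        rw [e2]
        refine (abs_sub _ _).trans (add_le_add ((abs_add_le _ _).trans ?_) b2)
        rw [abs_mul, abs_of_pos ha]
      generalize |V (n + 1) - f (x + a n)| = E' at *
      generalize |F (n + 1) - g (y + h n)| = D' at *
      have hE : 0 ≤ |V n - f x| := abs_nonneg _
      have hD : 0 ≤ |F n - g y| := abs_nonneg _
      generalize |V n - f x| = E at *
      generalize |F n - g y| = D at *
      have hQ : 0 ≤ |q| := abs_nonneg q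
      have hBε : 0 ≤ B * ε := by positivity
      have step : E' + D' + B * ε ≤ (E + D + B * ε) * (1 + (3 * |q| + 1) * a n) := by
        have c3 : a n * D' ≤ a n * (D + |q| * (E + B * ε)) := by
          refine mul_le_mul_of_nonneg_left (c1.trans ?_) ha.le
          have : |q| * a n * (E + B * ε) ≤ |q| * 1 * (E + B * ε) := by gcongr
          linarith
        have p1 : 0 ≤ a n * |q| * E := by positivity
        have p2 : 0 ≤ a n * |q| * D := by positivity
        have p3 : 0 ≤ a n * E := by positivity
        have p4 : 0 ≤ a n * (B * ε) := by positivity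
        nlinarith
      calc E' + D' + B * ε ≤ (E + D + B * ε) * (1 + (3 * |q| + 1) * a n) := step
        _ ≤ (B * ε * Real.exp ((3 * |q| + 1) * x)) * Real.exp ((3 * |q| + 1) * a n) := by
          refine mul_le_mul ih ?_ (by positivity) (by positivity)
          linarith [Real.add_one_le_exp ((3 * |q| + 1) * a n)]
        _ = B * ε * Real.exp ((3 * |q| + 1) * (x + a n)) := by
          rw [mul_assoc, ← Real.exp_add]; ring_nf
  have h1 := main n hn
  have h2 : Real.exp ((3 * |q| + 1) * ∑ p ∈ Finset.range n, a p) ≤ Real.exp (3 * |q| + 1) := by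
    refine Real.exp_le_exp.2 (mul_le_of_le_one_right (by positivity) (I.primary_mem hn).2)
  have h3 := mul_le_mul_of_nonneg_left h2 (by positivity : 0 ≤ B * ε)
  have h4 := abs_nonneg (F n - g (∑ p ∈ Finset.range n, h p))
  have h5 : 0 ≤ B * ε := by positivity
  linarith

theorem mul_abs_sub_le {f f' : ℝ → ℝ} {c lo hi x y : ℝ}
    (hf : ∀ t ∈ Set.Icc lo hi, HasDerivAt f (f' t) t) (hc : ∀ t ∈ Set.Icc lo hi, c ≤ f' t)
    (hx : x ∈ Set.Icc lo hi) (hy : y ∈ Set.Icc lo hi) : c * |y - x| ≤ |f y - f x| := by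
  have key : ∀ x ∈ Set.Icc lo hi, ∀ y ∈ Set.Icc lo hi, x ≤ y → c * |y - x| ≤ |f y - f x| := by
    intro x hx y hy hxy
    rw [abs_of_nonneg (sub_nonneg.2 hxy)]
    refine le_trans ?_ (le_abs_self _)
    refine (convex_Icc lo hi).mul_sub_le_image_sub_of_le_deriv
      (fun t ht => (hf t ht).continuousAt.continuousWithinAt)
      (fun t ht => ((hf t (interior_subset ht)).differentiableAt).differentiableWithinAt)
      (fun t ht => ?_) x hx y hy hxy
    rw [(hf t (interior_subset ht)).deriv]
    exact hc t (interior_subset ht)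
  rcases le_total x y with hxy | hxy
  · exact key x hx y hy hxy
  · rw [abs_sub_comm y, abs_sub_comm (f y)]
    exact key y hy x hx hxy

theorem continuous_sigmaQ (q : ℝ) : Continuous (sigmaQ q) := by
  have : sigmaQ q = fun x => genCos q x ^ 2 := funext (sigmaQ_eq_genCos_sq q)
  rw [this]; exact (continuous_genCos q).pow 2

theorem hasDerivAt_integral_sigmaQ (q x : ℝ) :
    HasDerivAt (fun x => ∫ t in (0 : ℝ)..x, sigmaQ q t) (sigmaQ q x) x :=
  ((continuous_sigmaQ q).integral_hasStrictDerivAt 0 x).hasDerivAt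

theorem monotone_integral_sigmaQ (q : ℝ) : Monotone fun x => ∫ t in (0 : ℝ)..x, sigmaQ q t :=
  monotone_of_deriv_nonneg (fun x => (hasDerivAt_integral_sigmaQ q x).differentiableAt) fun x => by
    rw [(hasDerivAt_integral_sigmaQ q x).deriv, sigmaQ_eq_genCos_sq]; positivity

theorem integral_one_div_sigmaQ {q : ℝ} (hq : -(Real.pi ^ 2 / 4) < q) {x : ℝ}
    (hx : x ∈ Set.Icc (0 : ℝ) 1) :
    ∫ t in (0 : ℝ)..x, 1 / sigmaQ q t = genSin q x / genCos q x := by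
  have hpos : ∀ t ∈ Set.uIcc 0 x, 0 < genCos q t := fun t ht => by
    rw [Set.uIcc_of_le hx.1] at ht
    exact genCos_pos_of_mem hq ⟨ht.1, ht.2.trans hx.2⟩
  rw [intervalIntegral.integral_eq_sub_of_hasDerivAt
    (f := fun x => genSin q x / genCos q x) fun t ht => hasDerivAt_genSin_div (hpos t ht).ne']
  · simp
  · refine ContinuousOn.intervalIntegrable
      (continuousOn_const.div (continuous_sigmaQ q).continuousOn fun t ht => ?_)
    rw [sigmaQ_eq_genCos_sq]
    exact (pow_pos (hpos t ht) 2).ne'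

/-- The grid points induced by the Liouville transform of an interlaced grid are close to
the grid points of the interlaced grid. -/
theorem exists_grid_close {q : ℝ} (hq : -(Real.pi ^ 2 / 4) < q) :
    ∃ K η : ℝ, 0 < η ∧ ∀ (l : ℕ) (a h : ℕ → ℝ) (ε : ℝ), Interlaced l a h ε → 0 ≤ ε → ε ≤ η →
      ∀ n ≤ l,
        (∀ y ∈ Set.Icc (0 : ℝ) 1, ∫ t in (0 : ℝ)..y, 1 / sigmaQ q t =
            ∑ p ∈ Finset.range n, a p / (pot a h q p * pot a h q (p + 1)) →
          |y - ∑ p ∈ Finset.range n, a p| ≤ K * ε) ∧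
        (∀ y, 0 ≤ y → ∫ t in (0 : ℝ)..y, sigmaQ q t =
            ∑ p ∈ Finset.range n, h p * pot a h q p ^ 2 →
          |y - ∑ p ∈ Finset.range n, h p| ≤ K * ε) := by
  -- an upper bound for the solutions on the unit interval
  obtain ⟨B, hB1, hBc, hBs, hBq⟩ : ∃ B : ℝ, 1 ≤ B ∧ (∀ x ∈ Set.Icc (0 : ℝ) 1, |genCos q x| ≤ B) ∧
      (∀ x ∈ Set.Icc (0 : ℝ) 1, |genSin q x| ≤ B) ∧
      (∀ x ∈ Set.Icc (0 : ℝ) 1, |q * genSin q x| ≤ B) := by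
    obtain ⟨b1, h1⟩ := isCompact_Icc.exists_bound_of_continuousOn
      (continuous_genCos q).continuousOn (s := Set.Icc (0 : ℝ) 1)
    obtain ⟨b2, h2⟩ := isCompact_Icc.exists_bound_of_continuousOn
      (continuous_genSin q).continuousOn (s := Set.Icc (0 : ℝ) 1)
    obtain ⟨b3, h3⟩ := isCompact_Icc.exists_bound_of_continuousOn
      ((continuous_genSin q).const_mul q).continuousOn (s := Set.Icc (0 : ℝ) 1)
    refine ⟨max (max b1 b2) (max b3 1), by simp, fun x hx => (h1 x hx).trans (by simp),
      fun x hx => (h2 x hx).trans (by simp), fun x hx => (h3 x hx).trans (by simp)⟩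
  -- a lower bound on a slightly larger interval
  obtain ⟨ρ, hρ, hqρ⟩ : ∃ ρ : ℝ, 0 < ρ ∧ -(Real.pi ^ 2 / 4) < q * (1 + ρ) ^ 2 := by
    have ht : Tendsto (fun ρ : ℝ => q * (1 + ρ) ^ 2) (𝓝[>] 0) (𝓝 (q * (1 + 0) ^ 2)) :=
      tendsto_nhdsWithin_of_tendsto_nhds ((by fun_prop : Continuous
        fun ρ : ℝ => q * (1 + ρ) ^ 2).tendsto 0)
    have h1 := ht.eventually (lt_mem_nhds (by simpa using hq))
    obtain ⟨ρ, h2, h3⟩ := (h1.and self_mem_nhdsWithin).exists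
    exact ⟨ρ, h3, h2⟩
  obtain ⟨m, hm0, hm⟩ : ∃ m : ℝ, 0 < m ∧ ∀ x ∈ Set.Icc (0 : ℝ) (1 + ρ), m ≤ genCos q x := by
    obtain ⟨x0, hx0, hmin⟩ := isCompact_Icc.exists_isMinOn
      (Set.nonempty_Icc.2 (by linarith : (0 : ℝ) ≤ 1 + ρ)) (continuous_genCos q).continuousOn
    exact ⟨_, genCos_pos hqρ hx0.1 hx0.2, fun x hx => hmin hx⟩
  have hm1 : ∀ x ∈ Set.Icc (0 : ℝ) 1, m ≤ genCos q x :=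
    fun x hx => hm x ⟨hx.1, by linarith [hx.2]⟩
  set K := B * Real.exp (3 * |q| + 1) with hK
  have hK0 : 0 < K := by positivity
  set L := (B + K) * (2 * B + 1) with hL
  have hL0 : 0 < L := by positivity
  -- `K * ε` is the error of the ladder and `L * ε` that of the Riemann sum for `∫ σ`. The three
  -- bounds in the minimum keep the discrete potentials above `m / 2`, make `K * ε ≤ 1`, and keep
  -- the dual nodes below `1 + ρ`.
  refine ⟨max (B ^ 2 * (4 * B * K / m ^ 2)) (L / m ^ 2),
    min (min (m / (2 * K)) (1 / K)) (m ^ 2 * ρ / (2 * L)), by positivity, ?_⟩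
  intro l a h ε I hε hεη n hn
  have hε1 : K * ε ≤ m / 2 := by
    have : ε ≤ m / (2 * K) := hεη.trans ((min_le_left _ _).trans (min_le_left _ _))
    rw [le_div_iff₀ (by positivity)] at this
    linarith
  have hε2 : K * ε ≤ 1 := by
    have : ε ≤ 1 / K := hεη.trans ((min_le_left _ _).trans (min_le_right _ _))
    rw [le_div_iff₀ hK0] at this
    linarith
  have hε3 : L * ε < m ^ 2 * ρ := by
    have : ε ≤ m ^ 2 * ρ / (2 * L) := hεη.trans (min_le_right _ _)
    rw [le_div_iff₀ (by positivity)] at this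
    have : 0 < m ^ 2 * ρ := by positivity
    linarith
  have sC : ∀ k ≤ l, |pot a h q k - genCos q (∑ p ∈ Finset.range k, a p)| ≤ K * ε :=
    fun k hk => I.ladder_close (hasDerivAt_genCos q)
      (fun x => (hasDerivAt_genSin q x).const_mul q) hBc hBq (isLadder_pot a h q)
      (by simp) (by simp) hε hk
  have spos : ∀ k ≤ l, m / 2 ≤ pot a h q k := fun k hk => by
    have h1 := (abs_le.1 (sC k hk)).1
    have h2 := hm1 _ (I.primary_mem hk)
    linarith
  constructor
  · intro y hy hint
    have HT := isLadder_ladder a h q (0, 1)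
    have TS : |(ladder a h q (0, 1) n).1 - genSin q (∑ p ∈ Finset.range n, a p)| ≤ K * ε :=
      I.ladder_close (hasDerivAt_genSin q) (hasDerivAt_genCos q) hBs hBc HT
        (by simp [ladder]) (by simp [ladder]) hε hn
    -- Both sides become quotients of a sine-type by a cosine-type solution, continuous at `y` and
    -- discrete at index `n`.
    rw [sum_div_pot HT rfl rfl fun k hk => by linarith [spos k (hk.trans hn)],
      integral_one_div_sigmaQ hq hy] at hint
    have hx := I.primary_mem hn
    have hs := spos n hn
    have hC := hm1 _ hx
    have hBc' := hBc _ hx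
    have hBs' := hBs _ hx
    have hsC := sC n hn
    set x := ∑ p ∈ Finset.range n, a p
    have d1 : 1 / B ^ 2 * |y - x| ≤ |genSin q y / genCos q y - genSin q x / genCos q x| := by
      refine mul_abs_sub_le (f := fun x => genSin q x / genCos q x)
        (f' := fun t => 1 / sigmaQ q t) (fun t ht =>
          hasDerivAt_genSin_div (genCos_pos_of_mem hq ht).ne') (fun t ht => ?_) hx hy
      have h0 := genCos_pos_of_mem hq ht
      have h1 := hBc t ht
      rw [abs_of_pos h0] at h1
      rw [sigmaQ_eq_genCos_sq]
      gcongr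
    have d2 : |genSin q y / genCos q y - genSin q x / genCos q x| ≤ 4 * B * K / m ^ 2 * ε := by
      rw [hint]
      have s0 : 0 < pot a h q n := by linarith
      have c0 : 0 < genCos q x := by linarith
      rw [div_sub_div _ _ s0.ne' c0.ne', abs_div, abs_of_pos (mul_pos s0 c0),
        div_le_iff₀ (mul_pos s0 c0)]
      have e : (ladder a h q (0, 1) n).1 * genCos q x - pot a h q n * genSin q x =
        ((ladder a h q (0, 1) n).1 - genSin q x) * genCos q x -
          (pot a h q n - genCos q x) * genSin q x := by ring
      have f1 : |(ladder a h q (0, 1) n).1 * genCos q x - pot a h q n * genSin q x| ≤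
          K * ε * B + K * ε * B := by
        rw [e]
        refine (abs_sub _ _).trans ?_
        rw [abs_mul, abs_mul]
        gcongr
      have f2 : m / 2 * m ≤ pot a h q n * genCos q x := by gcongr
      calc _ ≤ K * ε * B + K * ε * B := f1
        _ = 4 * B * K / m ^ 2 * ε * (m / 2 * m) := by field_simp; ring
        _ ≤ _ := by gcongr
    have d3 : |y - x| ≤ B ^ 2 * (4 * B * K / m ^ 2) * ε := by
      have := d1.trans d2
      rw [div_mul_eq_mul_div, one_mul, div_le_iff₀ (by positivity)] at this
      linarith
    exact d3.trans (mul_le_mul_of_nonneg_right (le_max_left _ _) hε)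
  · intro y hy hint
    set Θ : ℝ → ℝ := fun x => ∫ t in (0 : ℝ)..x, sigmaQ q t with hΘ
    have lipC : ∀ x ∈ Set.Icc (0 : ℝ) 1, ∀ y ∈ Set.Icc (0 : ℝ) 1,
        |genCos q y - genCos q x| ≤ B * |y - x| :=
      fun x hx y hy => (convex_Icc (0 : ℝ) 1).norm_image_sub_le_of_norm_hasDerivWithin_le
        (fun t _ => (hasDerivAt_genCos q t).hasDerivWithinAt) (fun t ht => hBq t ht) hx hy
    have riem : ∀ k ≤ l, |(∑ p ∈ Finset.range k, h p * pot a h q p ^ 2) -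
        Θ (∑ p ∈ Finset.range k, h p)| ≤ L * ε * ∑ p ∈ Finset.range k, h p := by
      intro k
      induction k with
      | zero => simp [hΘ]
      | succ k ih =>
        intro hk
        have hk' : k < l := by omega
        have ih := ih hk'.le
        have mx := I.primary_mem hk'.le
        have my := I.dual_mem hk'.le
        have my1 := I.dual_mem hk
        have o1 := I.dual_le_primary hk'.le
        have o2 := I.primary_le_dual_succ hk'
        have hsC := sC k hk'.le
        have hBc' := hBc _ mx
        rw [Finset.sum_range_succ] at my1 o2
        rw [Finset.sum_range_succ, Finset.sum_range_succ]
        set x := ∑ p ∈ Finset.range k, a p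
        set z := ∑ p ∈ Finset.range k, h p
        have hh := I.hpos k hk'
        have hhε : h k ≤ ε := (I.le k hk').trans (I.small k hk')
        have st : |Θ (z + h k) - Θ z - (z + h k - z) * pot a h q k ^ 2| ≤
            L * ε * (z + h k - z) := by
          refine abs_sub_sub_mul_le (by linarith) (fun t _ => hasDerivAt_integral_sigmaQ q t)
            fun t ht => ?_
          have ht' : t ∈ Set.Icc (0 : ℝ) 1 := ⟨by linarith [my.1, ht.1], by linarith [my1.2, ht.2]⟩
          have c1 := lipC x mx t ht'
          have c2 : |t - x| ≤ ε := abs_le.2 ⟨by linarith [ht.1], by linarith [ht.2]⟩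
          have c3 : |genCos q t - pot a h q k| ≤ (B + K) * ε := by
            calc |genCos q t - pot a h q k| = |(genCos q t - genCos q x) -
                (pot a h q k - genCos q x)| := by ring_nf
              _ ≤ |genCos q t - genCos q x| + |pot a h q k - genCos q x| := abs_sub _ _
              _ ≤ B * ε + K * ε := by
                refine add_le_add (c1.trans ?_) hsC
                gcongr
              _ = (B + K) * ε := by ring
          have c4 : |genCos q t + pot a h q k| ≤ 2 * B + 1 := by
            have h1 := abs_le.1 (hBc t ht')
            have h2 := abs_le.1 hBc'
            have h3 := abs_le.1 (hsC.trans hε2)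
            exact abs_le.2 ⟨by linarith, by linarith⟩
          rw [sigmaQ_eq_genCos_sq, sq_sub_sq, abs_mul, mul_comm]
          calc |genCos q t - pot a h q k| * |genCos q t + pot a h q k| ≤
              ((B + K) * ε) * (2 * B + 1) := by gcongr
            _ = L * ε := by rw [hL]; ring
        rw [add_sub_cancel_left] at st
        have e : ∑ p ∈ Finset.range k, h p * pot a h q p ^ 2 + h k * pot a h q k ^ 2 - Θ (z + h k) =
          (∑ p ∈ Finset.range k, h p * pot a h q p ^ 2 - Θ z) -
            (Θ (z + h k) - Θ z - h k * pot a h q k ^ 2) := by ring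
        rw [e, mul_add]
        exact (abs_sub _ _).trans (add_le_add ih st)
    have hz := I.dual_mem hn
    have r := riem n hn
    rw [← hint] at r
    set z := ∑ p ∈ Finset.range n, h p
    have r1 : |Θ y - Θ z| ≤ L * ε := r.trans (mul_le_of_le_one_right (by positivity) hz.2)
    have lower : ∀ x ∈ Set.Icc (0 : ℝ) (1 + ρ), ∀ y ∈ Set.Icc (0 : ℝ) (1 + ρ),
        m ^ 2 * |y - x| ≤ |Θ y - Θ x| := fun x hx y hy =>
      mul_abs_sub_le (fun t _ => hasDerivAt_integral_sigmaQ q t) (fun t ht => by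
        rw [sigmaQ_eq_genCos_sq]; have := hm t ht; gcongr) hx hy
    -- Otherwise `Θ` would gain at least `m ^ 2 * ρ` beyond `1`, more than the error `L * ε` allows.
    have hyρ : y ≤ 1 + ρ := by
      by_contra hc
      have l1 := lower 1 ⟨by norm_num, by linarith⟩ (1 + ρ) ⟨by linarith, le_rfl⟩
      have mono := monotone_integral_sigmaQ q
      have m1 : Θ (1 + ρ) ≤ Θ y := mono (not_le.1 hc).le
      have m2 : Θ z ≤ Θ 1 := mono hz.2
      have m3 : Θ 1 ≤ Θ (1 + ρ) := mono (by linarith)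
      rw [add_sub_cancel_left, abs_of_pos hρ, abs_of_nonneg (by linarith)] at l1
      have := (abs_le.1 r1).2
      linarith
    have l2 := (lower z ⟨hz.1, by linarith [hz.2]⟩ y ⟨hy, hyρ⟩).trans r1
    have d3 : |y - z| ≤ L / m ^ 2 * ε := by
      rw [div_mul_eq_mul_div, le_div_iff₀ (by positivity)]
      linarith
    exact d3.trans (mul_le_mul_of_nonneg_right (le_max_right _ _) hε)


/-! ### The networks of the two conductivities; existence and uniqueness of the induced grid. -/

theorem sum_fin_lt {l n : ℕ} (hn : n ≤ l) (f : ℕ → ℝ) :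
    ∑ p : Fin l with p.val < n, f p = ∑ p ∈ Finset.range n, f p := by
  rw [Finset.sum_filter, Fin.sum_univ_eq_sum_range (fun p => if p < n then f p else 0),
    ← Finset.sum_filter]
  congr 1
  ext p
  simp only [Finset.mem_filter, Finset.mem_range]
  omega

theorem sum_fin_Iic {l : ℕ} (j : Fin l) (f : ℕ → ℝ) :
    ∑ p ∈ Finset.Iic j, f p = ∑ p ∈ Finset.range (j + 1), f p := by
  refine Eq.trans ?_ (sum_fin_lt (Nat.succ_le_of_lt j.isLt) f)
  refine Finset.sum_congr (Finset.ext fun p => ?_) fun _ _ => rfl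
  rw [Finset.mem_Iic, Finset.mem_filter, Fin.le_def, Nat.lt_succ_iff]
  exact (and_iff_right (Finset.mem_univ p)).symm

section

variable {q : ℝ}

theorem neg_modeFreq_sq_injective (hq : -(Real.pi ^ 2 / 4) < q) (l : ℕ) :
    Function.Injective fun k : Fin l => -(modeFreq q k) ^ 2 := by
  have H := isSpectralData_modeFreq hq
  intro i j hij
  have h1 : modeFreq q i ^ 2 = modeFreq q j ^ 2 := neg_injective hij
  have := (pow_left_inj₀ (H.pos i).le (H.pos j).le two_ne_zero).1 h1
  exact Fin.ext (H.strictMono.injective this)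

theorem isTruncatedMeasureNetwork_iff (hq : -(Real.pi ^ 2 / 4) < q) {l : ℕ} (hl : 0 < l)
    {a h : ℕ → ℝ}
    (R : Resolves l a h (fun k => -(modeFreq q k) ^ 2) (fun _ => 2)) (c : NetworkParams l) :
    IsTruncatedMeasureNetwork (sigmaQ q) c ↔ c = networkOf l a h := by
  constructor
  · rintro ⟨δ, ξ, H, hc⟩
    obtain ⟨rfl, rfl⟩ := H.eq hq
    exact eq_networkOf hl R (neg_modeFreq_sq_injective hq l) hc
  · rintro rfl
    exact ⟨_, _, isSpectralData_modeFreq hq, solvesDiscreteInverse_networkOf hl R⟩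

theorem neg_pi_sq_lt_zero : -(Real.pi ^ 2 / 4) < 0 := by
  have := Real.pi_pos; have : 0 < Real.pi ^ 2 := by positivity
  linarith

/-- The primary steps of the network with the spectral measure of `sigmaQ q`. -/
noncomputable def shiftA (q : ℝ) (l n : ℕ) : ℝ :=
  refA l n / (pot (refA l) (refH l) q n * pot (refA l) (refH l) q (n + 1))

/-- The dual steps of the network with the spectral measure of `sigmaQ q`. -/
noncomputable def shiftH (q : ℝ) (l n : ℕ) : ℝ := refH l n * pot (refA l) (refH l) q n ^ 2

theorem resolves_ref_modeFreq {l : ℕ} (hl : 0 < l) :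
    Resolves l (refA l) (refH l) (fun k => -(modeFreq 0 k) ^ 2) (fun _ => 2) := by
  simpa only [modeFreq_sq neg_pi_sq_lt_zero, add_zero] using resolves_ref l hl

theorem resolves_shift (hq : -(Real.pi ^ 2 / 4) < q) {l : ℕ} (hl : 0 < l) :
    Resolves l (shiftA q l) (shiftH q l) (fun k => -(modeFreq q k) ^ 2) (fun _ => 2) := by
  have h := (resolves_ref_modeFreq hl).shift (neg_modeFreq_sq_injective neg_pi_sq_lt_zero l)
    (q := q) fun k => by
      rw [modeFreq_sq neg_pi_sq_lt_zero]; linarith [freq_sq_add_pos hq k]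
  have e : (fun k : Fin l => -(modeFreq q k) ^ 2) = fun k : Fin l => -(modeFreq 0 k) ^ 2 - q := by
    ext k
    rw [modeFreq_sq neg_pi_sq_lt_zero, modeFreq_sq hq]; ring
  rw [e]
  exact h

theorem Resolves.sum_a_le (hq : -(Real.pi ^ 2 / 4) < q) {l : ℕ} (hl : 0 < l) {a h : ℕ → ℝ}
    (R : Resolves l a h (fun k => -(modeFreq q k) ^ 2) (fun _ => 2)) :
    ∑ p ∈ Finset.range l, a p ≤ genSin q 1 / genCos q 1 := by
  rw [R.sum_a (neg_modeFreq_sq_injective hq l) hl fun k => by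
    rw [modeFreq_sq hq]; linarith [freq_sq_add_pos hq k]]
  simp only [neg_neg, modeFreq_sq hq]
  rw [Fin.sum_univ_eq_sum_range (fun k => 2 / ((Real.pi * (k + 1 / 2)) ^ 2 + q))]
  exact sum_le_genSin_div hq l

theorem interlaced_ref {l : ℕ} (hl : 2 ≤ l) : Interlaced l (refA l) (refH l) √(2 / l) := by
  refine ⟨fun n hn => refH_pos hn, fun n hn => refH_le_refA hn, fun n hn => refA_le_refH hn,
    fun n hn => (refA_le_last hn).trans ?_, ?_⟩
  · obtain ⟨m, rfl⟩ := Nat.exists_eq_add_of_le' hl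
    refine Real.le_sqrt_of_sq_le ?_
    simpa using refA_last_sq_le (m := m)
  · have := (resolves_ref_modeFreq (by omega : 0 < l)).sum_a_le neg_pi_sq_lt_zero (by omega)
    simpa [genSin, genCos] using this

/-- For negative `q` the integrand has zeros on the line. If the integral were constant on an
interval, `genCos q` and its derivative would vanish there, against `genCos_sq_sub`. -/
theorem strictMono_integral_sigmaQ (q : ℝ) :
    StrictMono fun x => ∫ t in (0 : ℝ)..x, sigmaQ q t := by
  refine (monotone_integral_sigmaQ q).strictMono_of_injective ?_
  have key : ∀ x y, x < y → (∫ t in (0 : ℝ)..x, sigmaQ q t) ≠ ∫ t in (0 : ℝ)..y, sigmaQ q t := by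
    intro x y hxy heq
    have hσ : ∀ z ∈ Set.Ioo x y, genCos q z = 0 := by
      intro z hz
      have hev : (fun x => ∫ t in (0 : ℝ)..x, sigmaQ q t) =ᶠ[𝓝 z]
          fun _ => ∫ t in (0 : ℝ)..x, sigmaQ q t := by
        filter_upwards [Ioo_mem_nhds hz.1 hz.2] with w hw
        have h1 := monotone_integral_sigmaQ q hw.1.le
        have h2 := monotone_integral_sigmaQ q hw.2.le
        simp only at h1 h2
        exact le_antisymm (by rw [heq]; exact h2) h1
      have h0 := (hasDerivAt_const z (∫ t in (0 : ℝ)..x, sigmaQ q t)).congr_of_eventuallyEq hev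
      have := (hasDerivAt_integral_sigmaQ q z).unique h0
      rwa [sigmaQ_eq_genCos_sq, sq_eq_zero_iff] at this
    have hm : (x + y) / 2 ∈ Set.Ioo x y := ⟨by linarith, by linarith⟩
    have hev : genCos q =ᶠ[𝓝 ((x + y) / 2)] fun _ => 0 := by
      filter_upwards [Ioo_mem_nhds hm.1 hm.2] with w hw using hσ w hw
    have h0 := (hasDerivAt_genCos q _).unique
      ((hasDerivAt_const _ (0 : ℝ)).congr_of_eventuallyEq hev)
    have := genCos_sq_sub q ((x + y) / 2)
    rw [hσ _ hm, sq (genSin q _), ← mul_assoc, h0] at this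
    norm_num at this
  intro x y hxy
  rcases lt_trichotomy x y with h | h | h
  · exact absurd hxy (key x y h)
  · exact h
  · exact absurd hxy.symm (key y x h)

theorem integral_sigmaQ (q x : ℝ) :
    ∫ t in (0 : ℝ)..x, sigmaQ q t = (x + genSin q x * genCos q x) / 2 := by
  rw [intervalIntegral.integral_eq_sub_of_hasDerivAt
    (f := fun x => (x + genSin q x * genCos q x) / 2) (fun t _ => ?_)
    ((continuous_sigmaQ q).intervalIntegrable _ _)]
  · simp
  · refine (((hasDerivAt_id t).add ((hasDerivAt_genSin q t).mul
      (hasDerivAt_genCos q t))).div_const 2).congr_deriv ?_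
    rw [sigmaQ_eq_genCos_sq]
    linear_combination (-1 / 2) * genCos_sq_sub q t

/-- Shows that `∫ σ` grows without bound, so a dual node exists for every nonnegative value. -/
theorem exists_le_genSin_mul_genCos (q : ℝ) :
    ∃ M, 0 ≤ M ∧ ∀ x, 0 ≤ x → -M ≤ genSin q x * genCos q x := by
  rcases lt_trichotomy q 0 with h | h | h
  · refine ⟨1 / √(-q), by positivity, fun x _ => ?_⟩
    have h' : 0 < √(-q) := Real.sqrt_pos.2 (by linarith)
    simp only [genSin, genCos, not_le.2 h, h.ne, if_false]
    rw [div_mul_eq_mul_div, neg_le, ← neg_div]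
    gcongr
    rw [neg_le]
    nlinarith [Real.sin_sq_add_cos_sq (√(-q) * x),
      sq_nonneg (Real.sin (√(-q) * x) + Real.cos (√(-q) * x))]
  · exact ⟨0, le_rfl, fun x hx => by simp [genSin, genCos, h, hx]⟩
  · refine ⟨0, le_rfl, fun x hx => ?_⟩
    simp only [genSin, genCos, h.le, h.ne', if_true, if_false, neg_zero]
    have h1 : 0 ≤ Real.sinh (√q * x) := Real.sinh_nonneg_iff.2 (by positivity)
    have h2 := Real.cosh_pos (√q * x)
    positivity

theorem existsUnique_dual (q : ℝ) {v : ℝ} (hv : 0 ≤ v) :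
    ∃! y, 0 ≤ y ∧ ∫ t in (0 : ℝ)..y, sigmaQ q t = v := by
  obtain ⟨M, hM, hb⟩ := exists_le_genSin_mul_genCos q
  have hcont : Continuous fun x => ∫ t in (0 : ℝ)..x, sigmaQ q t :=
    continuous_iff_continuousAt.2 fun x => (hasDerivAt_integral_sigmaQ q x).continuousAt
  -- At `x = 2 * v + M` the closed form `(x + genSin q x * genCos q x) / 2` is at least `v`.
  have hb0 : 0 ≤ 2 * v + M := by linarith
  obtain ⟨y, hy, hyv⟩ := intermediate_value_Icc hb0 hcont.continuousOn
    (show v ∈ Set.Icc _ _ from ⟨by simpa using hv, by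
      simp only [integral_sigmaQ]; linarith [hb _ hb0]⟩)
  exact ⟨y, ⟨hy.1, hyv⟩, fun z hz =>
    (strictMono_integral_sigmaQ q).injective (hz.2.trans hyv.symm)⟩

theorem existsUnique_primary (hq : -(Real.pi ^ 2 / 4) < q) {v : ℝ} (hv : 0 ≤ v)
    (hv1 : v ≤ genSin q 1 / genCos q 1) :
    ∃! y, y ∈ Set.Icc (0 : ℝ) 1 ∧ ∫ t in (0 : ℝ)..y, 1 / sigmaQ q t = v := by
  have hd : ∀ x ∈ Set.Icc (0 : ℝ) 1, HasDerivAt (fun x => genSin q x / genCos q x)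
      (1 / sigmaQ q x) x := fun x hx => hasDerivAt_genSin_div (genCos_pos_of_mem hq hx).ne'
  have hcont : ContinuousOn (fun x => genSin q x / genCos q x) (Set.Icc 0 1) :=
    fun x hx => (hd x hx).continuousAt.continuousWithinAt
  have hmono : StrictMonoOn (fun x => genSin q x / genCos q x) (Set.Icc 0 1) := by
    refine strictMonoOn_of_deriv_pos (convex_Icc 0 1) hcont fun x hx => ?_
    have hx := interior_subset hx
    have := genCos_pos_of_mem hq hx
    rw [(hd x hx).deriv, sigmaQ_eq_genCos_sq]
    positivity
  obtain ⟨y, hy, hyv⟩ := intermediate_value_Icc zero_le_one hcont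
    (show v ∈ Set.Icc _ _ from ⟨by simpa using hv, hv1⟩)
  refine ⟨y, ⟨hy, by rw [integral_one_div_sigmaQ hq hy]; exact hyv⟩, fun z hz => ?_⟩
  refine hmono.injOn hz.1 hy ?_
  simp only at hyv ⊢
  rw [← integral_one_div_sigmaQ hq hz.1, hz.2, hyv]

theorem existsUnique_inducedGrid (hq : -(Real.pi ^ 2 / 4) < q) {l : ℕ} {a h : ℕ → ℝ}
    (ha : ∀ n < l, 0 < a n) (hh : ∀ n < l, 0 < h n)
    (hsum : ∑ p ∈ Finset.range l, a p ≤ genSin q 1 / genCos q 1) :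
    ∃! g : Grid l, IsInducedGrid (sigmaQ q) (networkOf l a h) g := by
  have P : ∀ j : Fin l, ∃! y, y ∈ Set.Icc (0 : ℝ) 1 ∧ ∫ t in (0 : ℝ)..y, 1 / sigmaQ q t =
      ∑ p ∈ Finset.Iic j, (networkOf l a h).al p := by
    intro j
    refine existsUnique_primary hq (Finset.sum_nonneg fun p _ => (ha p p.isLt).le)
      (le_trans ?_ hsum)
    simp only [networkOf]
    rw [sum_fin_Iic j a]
    exact Finset.sum_le_sum_of_subset_of_nonneg (Finset.range_subset_range.2 j.isLt)
      fun p hp _ => (ha p (Finset.mem_range.1 hp)).le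
  have D : ∀ j : Fin l, ∃! y, 0 ≤ y ∧ ∫ t in (0 : ℝ)..y, sigmaQ q t =
      ∑ p ∈ Finset.Iic j, (networkOf l a h).hal p := fun j =>
    existsUnique_dual q (Finset.sum_nonneg fun p _ => (hh p p.isLt).le)
  choose y hy hyu using P
  choose z hz hzu using D
  refine ⟨⟨Fin.cons 0 y, Fin.cons 0 z⟩, ⟨rfl, rfl, fun j => ?_, fun j => ?_, fun j => ?_,
    fun j => ?_⟩, fun g hg => ?_⟩
  · refine Fin.cases ?_ (fun j => ?_) j
    · simp
    · simpa using (hy j).1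
  · refine Fin.cases ?_ (fun j => ?_) j
    · simp
    · simpa using (hz j).1
  · simpa using (hy j).2
  · simpa using (hz j).2
  · ext j
    · refine Fin.cases ?_ (fun j => ?_) j
      · simpa using hg.primary_zero
      · simpa using hyu j _ ⟨hg.primary_mem _, hg.primary_eq j⟩
    · refine Fin.cases ?_ (fun j => ?_) j
      · simpa using hg.dual_zero
      · simpa using hzu j _ ⟨hg.dual_nonneg _, hg.dual_eq j⟩

theorem IsInducedGrid.integral_primary {σ : ℝ → ℝ} {l : ℕ} {a h : ℕ → ℝ} {g : Grid l}
    (H : IsInducedGrid σ (networkOf l a h) g) (j : Fin (l + 1)) :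
    ∫ t in (0 : ℝ)..(g.primary j), 1 / σ t = ∑ p ∈ Finset.range j, a p := by
  refine Fin.cases ?_ (fun j => ?_) j
  · simp [H.primary_zero]
  · rw [H.primary_eq]
    simp only [networkOf]
    rw [sum_fin_Iic j a, Fin.val_succ]

theorem IsInducedGrid.integral_dual {σ : ℝ → ℝ} {l : ℕ} {a h : ℕ → ℝ} {g : Grid l}
    (H : IsInducedGrid σ (networkOf l a h) g) (j : Fin (l + 1)) :
    ∫ t in (0 : ℝ)..(g.dual j), σ t = ∑ p ∈ Finset.range j, h p := by
  refine Fin.cases ?_ (fun j => ?_) j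
  · simp [H.dual_zero]
  · rw [H.dual_eq]
    simp only [networkOf]
    rw [sum_fin_Iic j h, Fin.val_succ]

theorem tendsto_sqrt_two_div : Tendsto (fun l : ℕ => √(2 / (l : ℝ))) atTop (𝓝 0) := by
  have := (tendsto_const_div_atTop_nhds_zero_nat (2 : ℝ)).sqrt
  simpa using this

end

end OptGrid

theorem corollary1 (q : ℝ) (hq : -(Real.pi ^ 2 / 4) < q) :
    -- the parameters and the grids are well defined, for every number of layers
    (∀ l : ℕ, 0 < l →
      (∃! c : OptGrid.NetworkParams l,
        OptGrid.IsTruncatedMeasureNetwork OptGrid.sigmaRef c) ∧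
      (∃! c : OptGrid.NetworkParams l,
        OptGrid.IsTruncatedMeasureNetwork (OptGrid.sigmaQ q) c) ∧
      (∀ c : OptGrid.NetworkParams l,
        OptGrid.IsTruncatedMeasureNetwork (OptGrid.sigmaQ q) c →
          ∃! g : OptGrid.Grid l, OptGrid.IsInducedGrid (OptGrid.sigmaQ q) c g)) ∧
    -- the induced grid is asymptotically the optimal grid
    (∀ (cRef cQ : (l : ℕ) → OptGrid.NetworkParams l) (gQ : (l : ℕ) → OptGrid.Grid l),
      (∀ l : ℕ, 0 < l →
        OptGrid.IsTruncatedMeasureNetwork OptGrid.sigmaRef (cRef l) ∧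
        OptGrid.IsTruncatedMeasureNetwork (OptGrid.sigmaQ q) (cQ l) ∧
        OptGrid.IsInducedGrid (OptGrid.sigmaQ q) (cQ l) (gQ l)) →
      Tendsto (fun l : ℕ => ⨆ j : Fin (l + 1),
        |(gQ l).primary j - (OptGrid.optimalGrid (cRef l)).primary j|) atTop (𝓝 0) ∧
      Tendsto (fun l : ℕ => ⨆ j : Fin (l + 1),
        |(gQ l).dual j - (OptGrid.optimalGrid (cRef l)).dual j|) atTop (𝓝 0)) := by

  refine ⟨fun l hl => ⟨?_, ?_, ?_⟩, ?_⟩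
  · rw [← OptGrid.sigmaQ_zero]
    simp only [OptGrid.isTruncatedMeasureNetwork_iff OptGrid.neg_pi_sq_lt_zero hl
      (OptGrid.resolves_ref_modeFreq hl)]
    exact existsUnique_eq
  · simp only [OptGrid.isTruncatedMeasureNetwork_iff hq hl (OptGrid.resolves_shift hq hl)]
    exact existsUnique_eq
  · intro c hc
    have R := OptGrid.resolves_shift hq hl
    rw [OptGrid.isTruncatedMeasureNetwork_iff hq hl R] at hc
    rw [hc]
    exact OptGrid.existsUnique_inducedGrid hq R.apos R.hpos (R.sum_a_le hq hl)
  · intro cRef cQ gQ H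
    obtain ⟨K, η, hη, close⟩ := OptGrid.exists_grid_close hq
    have bound : ∀ᶠ l : ℕ in atTop, ∀ j : Fin (l + 1),
        |(gQ l).primary j - (OptGrid.optimalGrid (cRef l)).primary j| ≤ K * √(2 / (l : ℝ)) ∧
        |(gQ l).dual j - (OptGrid.optimalGrid (cRef l)).dual j| ≤ K * √(2 / (l : ℝ)) := by
      -- The mesh bound needs at least two layers, and `exists_grid_close` needs the mesh below the
      -- threshold `η`.
      filter_upwards [eventually_ge_atTop 2,
        OptGrid.tendsto_sqrt_two_div.eventually (ge_mem_nhds hη)] with l hl hle j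
      have hl0 : 0 < l := by omega
      obtain ⟨h1, h2, h3⟩ := H l hl0
      rw [← OptGrid.sigmaQ_zero, OptGrid.isTruncatedMeasureNetwork_iff OptGrid.neg_pi_sq_lt_zero
        hl0 (OptGrid.resolves_ref_modeFreq hl0)] at h1
      rw [OptGrid.isTruncatedMeasureNetwork_iff hq hl0 (OptGrid.resolves_shift hq hl0)] at h2
      rw [h2] at h3
      have hj : j.val ≤ l := Nat.lt_succ_iff.1 j.isLt
      obtain ⟨c1, c2⟩ := close l _ _ _ (OptGrid.interlaced_ref hl) (Real.sqrt_nonneg _) hle j hj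
      have e1 : (OptGrid.optimalGrid (cRef l)).primary j =
          ∑ p ∈ Finset.range j, OptGrid.refA l p := by
        rw [h1]; exact OptGrid.sum_fin_lt hj (OptGrid.refA l)
      have e2 : (OptGrid.optimalGrid (cRef l)).dual j =
          ∑ p ∈ Finset.range j, OptGrid.refH l p := by
        rw [h1]; exact OptGrid.sum_fin_lt hj (OptGrid.refH l)
      rw [e1, e2]
      exact ⟨c1 _ (h3.primary_mem j) (h3.integral_primary j),
        c2 _ (h3.dual_nonneg j) (h3.integral_dual j)⟩
    have lim : Tendsto (fun l : ℕ => K * √(2 / (l : ℝ))) atTop (𝓝 0) := by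
      simpa using OptGrid.tendsto_sqrt_two_div.const_mul K
    exact ⟨squeeze_zero' (Eventually.of_forall fun l => Real.iSup_nonneg fun _ => abs_nonneg _)
        (bound.mono fun l hl => ciSup_le fun j => (hl j).1) lim,
      squeeze_zero' (Eventually.of_forall fun l => Real.iSup_nonneg fun _ => abs_nonneg _)
        (bound.mono fun l hl => ciSup_le fun j => (hl j).2) lim⟩
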